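/- Let $n\ge 1$ and $q\in\mathbb{C}\setminus\{0\}$, and put $\mu_{ij}=q$ if $i<j$, $\mu_{ij}=1$ if $i=j$, $\mu_{ij}=q^{-1}$ if $i>j$. Let $A=\widetilde{\mathcal O}_q(\mathrm{GL}(n))$ be the unital $\mathbb{C}$-algebra generated by $a_{ij}$ ($1\le i,j\le n$) and $D^{-1}$ with relations $$a_{ik}a_{jl}=\mu_{ij}\mu_{lk}\,a_{jl}a_{ik}\ \ (\forall\, i,j,k,l),\qquad DD^{-1}=D^{-1}D=1,\qquad D:=\sum_{\sigma\in S_n}(-q^{-1})^{\mathrm{inv}(\sigma)}a_{1\sigma(1)}\cdots a_{n\sigma(n)} .$$ Let $H=A/(a_{s1},\ s\neq1)$, let $p_{ij},\tilde D^{-1}$ be the images of $a_{ij},D^{-1}$; $H$ is a Hopf algebra with $\Delta(p_{ij})=\sum_k p_{ik}\otimes p_{kj}$, $\varepsilon(p_{ij})=\delta_{ij}$, $\tilde D^{-1}$ group-like, antipode $S$, and $p_{11}$ is invertible. Let $pr_0:H\to H_0=H/(p_{1s},\ s\neq 1)$ be the quotient map, let ${}^{\mathrm{co}H_0}H=\{k\in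 H: pr_0(k_{(1)})\otimes k_{(2)}=1\otimes k\}$ and $\beta_s=p_{11}^{-1}p_{1s}\in{}^{\mathrm{co}H_0}H$, $s=2,\dots,n$. For $\ell=1,\dots,n$ let $A_\ell=A[a_{\ell1}^{-1}]$, with the right $H$-coaction $\delta_\ell:A_\ell\to A_\ell\otimes H$, the algebra map with $a_{ij}\mapsto\sum_k a_{ik}\otimes p_{kj}$, $D^{-1}\mapsto D^{-1}\otimes\tilde D^{-1}$, $a_{\ell1}^{-1}\mapsto a_{\ell1}^{-1}\otimes p_{11}^{-1}$, and let $B_\ell=\{b\in A_\ell:\delta_\ell(b)=b\otimes1\}$. For $\ell<m$ let $A_{\ell m}=A[a_{\ell1}^{-1},a_{m1}^{-1}]$; let $\rho_{\ell,\ell m}:A_\ell\to A_{\ell m}$ be the canonical map, and let $\rho_{m,\ell m}:A_m\to A_{\ell m}$ be the canonical map $A_m\to A_{\ell m}$ followed by the algebra map $\Psi_{m\ell}:A_{\ell m}\to A_{\ell m}$ with, for all $k$, $$a_{\ell k}\mapsto a_{\ell1}a_{m1}^{-1}a_{mk},\quad a_{mk}\mapsto a_{m1}a_{\ell1}^{-1}a_{\ell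 k},\quad a_{jk}\mapsto a_{jk}\ (j\ne\ell,m),\quad a_{\ell1}^{-1}\mapsto a_{\ell1}^{-1},\quad a_{m1}^{-1}\mapsto a_{m1}^{-1},\quad D^{-1}\mapsto -D^{-1}.$$ **Proposition.** For every $\ell$ the extension $B_\ell\subset A_\ell$ is $H$-Galois, i.e. the canonical map $\chi_\ell:A_\ell\otimes_{B_\ell}A_\ell\to A_\ell\otimes H$, $x\otimes y\mapsto (x\otimes1)\,\delta_\ell(y)$, is bijective; write $h^{\langle1\rangle}\otimes h^{\langle2\rangle}=\chi_\ell^{-1}(1\otimes h)$ for the translation map. There is exactly one algebra map $f_\ell:{}^{\mathrm{co}H_0}H\to A_\ell$ with $f_\ell(\beta_s)=a_{\ell1}^{-1}a_{\ell s}$ for $s=2,\dots,n$, and these maps have the following properties. 1. $f_\ell$ takes values in the centralizer of $B_\ell$ in $A_\ell$. 2. $f_\ell$ is a map of right $H$-modules for the adjoint action on ${}^{\mathrm{co}H_0}H$ (which is stable under it) and the Miyashita–Ulbrich action on the centralizer: $f_\ell\big(S(h_{(1)})\,k\,h_{(2)}\big)=h^{\langle1\rangle}f_\ell(k)\,h^{\langle2\rangle}$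 for all $k\in{}^{\mathrm{co}H_0}H$, $h\in H$. 3. $f_\ell$ is a map of right $H$-comodule algebras: for all $k\in{}^{\mathrm{co}H_0}H$ one has $\Delta(k)\in{}^{\mathrm{co}H_0}H\otimes H$ and $\delta_\ell(f_\ell(k))=f_\ell(k_{(1)})\otimes k_{(2)}$. 4. $\rho_{\ell,\ell m}\circ f_\ell=\rho_{m,\ell m}\circ f_m$ for all $\ell<m$. -/

import Mathlib

open scoped TensorProduct

namespace QuantumGL

section QuantumDeterminant

variable {K : Type*} [Field K] {n : ℕ}

/-- The coefficients `μ i j`: equal to `q` for `i < j`, to `1` for `i = j`, to `q⁻¹` for `j < i`. -/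
def mu (q : Kˣ) (i j : Fin n) : Kˣ :=
  if i < j then q else if i = j then 1 else q⁻¹

/-- The matrix `M` satisfies `M i k * M j l = μ i j μ l k M j l * M i k` for all indices. -/
def IsQMatrix {R : Type*} [Ring R] [Algebra K R] (q : Kˣ) (M : Matrix (Fin n) (Fin n) R) : Prop :=
  ∀ i j k l, M i k * M j l = (mu q i j * mu q l k) • (M j l * M i k)

/-- The coefficient of the permutation `σ` in the quantum determinant: a factor `-q⁻¹` for every
inversion of `σ`. -/
def detCoeff (q : Kˣ) (σ : Equiv.Perm (Fin n)) : Kˣ :=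
  ∏ i, ∏ j ∈ Finset.Ioi i, if σ j < σ i then -q⁻¹ else 1

/-- The quantum determinant `∑ σ, (-q⁻¹) ^ inv σ • M 1 (σ 1) ⋯ M n (σ n)` (ordered product). -/
def qdet {R : Type*} [Ring R] [Algebra K R] (q : Kˣ) (M : Matrix (Fin n) (Fin n) R) : R :=
  ∑ σ : Equiv.Perm (Fin n), detCoeff q σ • (List.ofFn fun i => M i (σ i)).prod

theorem mu_mul_mu (q : Kˣ) (i j : Fin n) : mu q i j * mu q j i = 1 := by
  unfold mu
  rcases lt_trichotomy i j with h | h | h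
  · simp [h, h.not_gt, h.ne']
  · simp [h]
  · simp [h, h.not_gt, h.ne']

theorem mu_inv (q : Kˣ) (i j : Fin n) : (mu q i j)⁻¹ = mu q j i :=
  inv_eq_of_mul_eq_one_right (mu_mul_mu q i j)

@[simp] theorem mu_self (q : Kˣ) (i : Fin n) : mu q i i = 1 := by simp [mu]

/-! Families that commute up to scalars, and the normalisation of their ordered products. -/

section Lists

variable {ι R : Type*} [Ring R] [Algebra K R]

def listWt (c : ι → ι → Kˣ) : List ι → Kˣ
  | [] => 1
  | x :: L => (L.map (c x)).prod * listWt c L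

def listNorm (c : ι → ι → Kˣ) (E : ι → R) (L : List ι) : R := listWt c L • (L.map E).prod

theorem listNorm_perm {c : ι → ι → Kˣ} {E : ι → R}
    (h : ∀ x y, c x y • (E x * E y) = c y x • (E y * E x)) {L L' : List ι} (p : L.Perm L') :
    listNorm c E L = listNorm c E L' := by
  induction p with
  | nil => rfl
  | cons x p ih =>
    simp only [listNorm, listWt, List.map_cons, List.prod_cons, mul_smul] at ih ⊢
    rw [(p.map (c x)).prod_eq, ← mul_smul_comm, ih, mul_smul_comm]
  | swap x y l =>
    have h' := congrArg (fun z => ((l.map (c y)).prod * ((l.map (c x)).prod * listWt c l)) •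
      (z * (l.map E).prod)) (h y x)
    simp only [smul_mul_assoc, smul_smul, mul_assoc] at h'
    simp only [listNorm, listWt, List.map_cons, List.prod_cons]
    convert h' using 2
    · ac_rfl
    · ac_rfl
  | trans _ _ ih1 ih2 => exact ih1.trans ih2

theorem listWt_ofFn (c : ι → ι → Kˣ) {m : ℕ} (g : Fin m → ι) :
    listWt c (List.ofFn g) = ∏ i, ∏ j ∈ Finset.Ioi i, c (g i) (g j) := by
  induction m with
  | zero => simp [listWt]
  | succ m ih =>
    rw [List.ofFn_succ, listWt, ih, Fin.prod_univ_succ, Fin.prod_Ioi_zero]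
    simp [Fin.prod_Ioi_succ, List.prod_ofFn, Function.comp_def]

theorem listWt_append_singleton (c : ι → ι → Kˣ) (L : List ι) (x : ι) :
    listWt c (L ++ [x]) = listWt c L * (L.map fun y => c y x).prod := by
  induction L with
  | nil => simp [listWt]
  | cons y L ih => simp [listWt, ih]; ac_rfl

/-- The sign of a permutation, as a unit of the field. -/
def sg (σ : Equiv.Perm (Fin n)) : Kˣ := Units.map (Int.castRingHom K).toMonoidHom (Equiv.Perm.sign σ)

theorem sg_mul (σ τ : Equiv.Perm (Fin n)) : (sg (σ * τ) : Kˣ) = sg σ * sg τ := by simp [sg]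

theorem sg_inv (σ : Equiv.Perm (Fin n)) : (sg σ⁻¹ : Kˣ) = sg σ := by simp [sg]

theorem sg_swap {a b : Fin n} (h : a ≠ b) : (sg (Equiv.swap a b) : Kˣ) = -1 := by
  ext; simp [sg, Equiv.Perm.sign_swap h]

def altSum (c : ι → ι → Kˣ) (E : ι → R) (g : Fin n → Fin n → ι) : R :=
  ∑ σ : Equiv.Perm (Fin n), (sg σ : Kˣ) • listNorm c E (List.ofFn fun i => g i (σ i))

theorem altSum_comp {c : ι → ι → Kˣ} {E : ι → R}
    (h : ∀ x y, c x y • (E x * E y) = c y x • (E y * E x)) (g : Fin n → Fin n → ι)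
    (τ : Equiv.Perm (Fin n)) :
    altSum c E (fun i k => g (τ i) k) = (sg τ : Kˣ) • altSum c E g := by
  unfold altSum
  rw [Finset.smul_sum]
  refine Fintype.sum_equiv (Equiv.mulRight τ⁻¹) _ _ fun σ => ?_
  have : listNorm c E (List.ofFn fun i => g (τ i) (σ i)) =
      listNorm c E (List.ofFn fun i => g i ((σ * τ⁻¹) i)) := by
    refine listNorm_perm h ?_
    have := Equiv.Perm.ofFn_comp_perm τ (fun i => g i ((σ * τ⁻¹) i))
    simpa [Function.comp_def] using this
  rw [this, Equiv.coe_mulRight, sg_mul, sg_inv, smul_smul, ← mul_assoc, mul_right_comm]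
  have h2 : (sg τ * sg τ : Kˣ) = 1 := by rw [← sg_mul]; simp [sg]
  rw [h2, one_mul]

theorem altSum_eq_zero {c : ι → ι → Kˣ} {E : ι → R}
    (h : ∀ x y, c x y • (E x * E y) = c y x • (E y * E x)) (g : Fin n → Fin n → ι)
    {a b : Fin n} (hab : a ≠ b) (hg : g a = g b) : altSum c E g = 0 := by
  unfold altSum
  refine Finset.sum_involution (fun σ _ => σ * Equiv.swap a b) ?_ ?_ ?_ ?_
  · intro σ _
    have : listNorm c E (List.ofFn fun i => g i ((σ * Equiv.swap a b) i)) =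
        listNorm c E (List.ofFn fun i => g i (σ i)) := by
      refine listNorm_perm h ?_
      have := Equiv.Perm.ofFn_comp_perm (Equiv.swap a b) (fun i => g i (σ i))
      refine List.Perm.trans (List.Perm.of_eq ?_) this
      congr 1
      funext i
      have hi : g i = g (Equiv.swap a b i) := by
        rcases eq_or_ne i a with rfl | hia
        · rw [Equiv.swap_apply_left, hg]
        · rcases eq_or_ne i b with rfl | hib
          · rw [Equiv.swap_apply_right, hg]
          · rw [Equiv.swap_apply_of_ne_of_ne hia hib]
      exact congrFun hi _
    rw [this, sg_mul, sg_swap hab]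
    simp [Units.smul_def]
  · intro σ _ _ hσ
    have := mul_eq_left.mp hσ
    exact hab (Equiv.swap_eq_one_iff.mp this)
  · intro σ _; exact Finset.mem_univ _
  · intro σ _; simp [mul_assoc]

end Lists

/-! Expansion of the quantum determinant. -/

def chi (q : Kˣ) (i j : Fin n) : Kˣ := if i < j then q else 1

theorem mu_mul_chi (q : Kˣ) (i j : Fin n) : mu q i j * chi q j i = chi q i j := by
  unfold mu chi
  rcases lt_trichotomy i j with h | h | h
  · simp [h, h.not_gt]
  · simp [h]
  · simp [h, h.not_gt, h.ne']

def pairWt (q : Kˣ) (x y : Fin n × Fin n) : Kˣ := (chi q x.1 y.1)⁻¹ * chi q x.2 y.2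

variable {R : Type*} [Ring R] [Algebra K R] {q : Kˣ}

theorem IsQMatrix.pair {M : Matrix (Fin n) (Fin n) R} (hM : IsQMatrix q M) (x y : Fin n × Fin n) :
    pairWt q x y • (M x.1 x.2 * M y.1 y.2) = pairWt q y x • (M y.1 y.2 * M x.1 x.2) := by
  rw [hM x.1 y.1 x.2 y.2, smul_smul]
  congr 1
  unfold pairWt
  rw [← mu_mul_chi q x.1 y.1, ← mu_mul_chi q y.2 x.2, mul_inv]
  calc _ = (mu q x.1 y.1)⁻¹ * mu q x.1 y.1 *
        ((chi q y.1 x.1)⁻¹ * (mu q y.2 x.2 * chi q x.2 y.2)) := by ac_rfl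
    _ = _ := by rw [inv_mul_cancel, one_mul]

theorem sg_mul_listWt (σ : Equiv.Perm (Fin n)) :
    sg σ * listWt (pairWt q) (List.ofFn fun i => (i, σ i)) = detCoeff q σ := by
  have h1 : (sg σ : Kˣ) = ∏ i, ∏ j ∈ Finset.Ioi i, if σ j < σ i then -1 else 1 := by
    rw [sg, Equiv.Perm.sign_eq_prod_prod_Ioi]
    simp only [map_prod]
    refine Finset.prod_congr rfl fun i _ => Finset.prod_congr rfl fun j hj => ?_
    have hij : σ i ≠ σ j := fun h => (Finset.mem_Ioi.mp hj).ne (σ.injective h)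
    rcases lt_or_gt_of_ne hij with h | h
    · simp [h, h.not_gt]
    · simp only [h, h.not_gt, if_true, if_false]; ext; simp
  rw [h1, listWt_ofFn, detCoeff, ← Finset.prod_mul_distrib]
  refine Finset.prod_congr rfl fun i _ => ?_
  rw [← Finset.prod_mul_distrib]
  refine Finset.prod_congr rfl fun j hj => ?_
  have hij : σ i ≠ σ j := fun h => (Finset.mem_Ioi.mp hj).ne (σ.injective h)
  rcases lt_or_gt_of_ne hij with h | h
  · simp [pairWt, chi, h, h.not_gt, Finset.mem_Ioi.mp hj]
  · simp [pairWt, chi, h, h.not_gt, Finset.mem_Ioi.mp hj]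

theorem qdet_eq_altSum (M : Matrix (Fin n) (Fin n) R) :
    qdet q M = altSum (pairWt q) (fun x => M x.1 x.2) (fun i k => (i, k)) := by
  unfold qdet altSum
  refine Finset.sum_congr rfl fun σ _ => ?_
  rw [← sg_mul_listWt, listNorm, smul_smul, List.map_ofFn]
  rfl

theorem qdet_map {R' : Type*} [Ring R'] [Algebra K R'] (f : R →ₐ[K] R')
    (M : Matrix (Fin n) (Fin n) R) : qdet q (M.map f) = f (qdet q M) := by
  simp only [qdet, map_sum, Units.smul_def, map_smul, map_list_prod, List.map_ofFn, Matrix.map_apply,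
    Function.comp_def]

theorem IsQMatrix.map {R' : Type*} [Ring R'] [Algebra K R'] (f : R →ₐ[K] R')
    {M : Matrix (Fin n) (Fin n) R} (hM : IsQMatrix q M) : IsQMatrix q (M.map f) := by
  intro i j k l
  simp only [Matrix.map_apply, ← map_mul, hM i j k l, Units.smul_def, map_smul]

theorem sum_fun_eq_sum_perm {V : Type*} [AddCommMonoid V] (F : (Fin n → Fin n) → V)
    (hF : ∀ κ, ¬ Function.Injective κ → F κ = 0) : ∑ κ, F κ = ∑ σ : Equiv.Perm (Fin n), F σ := by
  symm
  refine Finset.sum_of_injOn (fun σ : Equiv.Perm (Fin n) => (σ : Fin n → Fin n)) ?_ ?_ ?_ ?_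
  · intro σ _ τ _ h; exact DFunLike.coe_injective h
  · intro σ _; simp
  · intro κ _ hκ
    refine hF κ fun hinj => hκ ?_
    exact ⟨Equiv.ofBijective κ (Finite.injective_iff_bijective.mp hinj), by simp, rfl⟩
  · intro σ _; rfl

theorem prod_ofFn_mul {m : ℕ} (f g : Fin m → R) (h : ∀ i j, Commute (f i) (g j)) :
    (List.ofFn fun i => f i * g i).prod = (List.ofFn f).prod * (List.ofFn g).prod := by
  induction m with
  | zero => simp
  | succ m ih =>
    simp only [List.ofFn_succ, List.prod_cons]
    rw [ih _ _ fun i j => h _ _]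
    have hc : Commute (List.ofFn fun i : Fin m => f i.succ).prod (g 0) := by
      refine Commute.list_prod_left _ _ fun x hx => ?_
      obtain ⟨i, rfl⟩ := (List.mem_ofFn' _ _).mp hx
      exact h _ _
    simp only [mul_assoc]
    rw [← mul_assoc (g 0), ← hc.eq, mul_assoc]

theorem qdet_mul {X Y : Matrix (Fin n) (Fin n) R} (hY : IsQMatrix q Y)
    (h : ∀ i j k l, Commute (X i j) (Y k l)) : qdet q (X * Y) = qdet q X * qdet q Y := by
  have e1 : qdet q (X * Y) = ∑ κ : Fin n → Fin n,
      listNorm (pairWt q) (fun x => X x.1 x.2) (List.ofFn fun i => (i, κ i)) *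
        altSum (pairWt q) (fun x => Y x.1 x.2) (fun i k => (κ i, k)) := by
    unfold qdet altSum
    simp only [Finset.mul_sum]
    rw [Finset.sum_comm]
    refine Finset.sum_congr rfl fun σ _ => ?_
    have e2 : (List.ofFn fun i => (X * Y) i (σ i)).prod = ∑ κ : Fin n → Fin n,
        (List.ofFn fun i => X i (κ i)).prod * (List.ofFn fun i => Y (κ i) (σ i)).prod := by
      simp only [Matrix.mul_apply]
      have := MultilinearMap.map_sum (MultilinearMap.mkPiAlgebraFin ℤ n R)
        (fun i k => X i k * Y k (σ i))
      simp only [MultilinearMap.mkPiAlgebraFin_apply] at this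
      rw [this]
      exact Finset.sum_congr rfl fun κ _ => prod_ofFn_mul _ _ fun i j => h _ _ _ _
    rw [e2, Finset.smul_sum]
    refine Finset.sum_congr rfl fun κ _ => ?_
    have e3 : listWt (pairWt q) (List.ofFn fun i => (i, σ i)) =
        listWt (pairWt q) (List.ofFn fun i => (i, κ i)) *
          listWt (pairWt q) (List.ofFn fun i => (κ i, σ i)) := by
      simp only [listWt_ofFn, ← Finset.prod_mul_distrib, pairWt]
      refine Finset.prod_congr rfl fun i _ => Finset.prod_congr rfl fun j _ => ?_
      group
    simp only [← sg_mul_listWt, e3, listNorm, List.map_ofFn, Function.comp_def, smul_mul_assoc,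
      mul_smul_comm, smul_smul]
    congr 1
    ac_rfl
  rw [e1, sum_fun_eq_sum_perm]
  · rw [qdet_eq_altSum Y]
    simp only [altSum_comp hY.pair (fun i k => (i, k)), mul_smul_comm]
    rw [qdet_eq_altSum X]
    conv_rhs => rw [altSum, Finset.sum_mul]
    simp only [smul_mul_assoc]
  · intro κ hκ
    simp only [Function.Injective, not_forall] at hκ
    obtain ⟨a, b, hab, hne⟩ := hκ
    rw [altSum_eq_zero hY.pair _ hne (by simp [hab]), mul_zero]

theorem IsQMatrix.mul {X Y : Matrix (Fin n) (Fin n) R} (hX : IsQMatrix q X) (hY : IsQMatrix q Y)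
    (h : ∀ i j k l, Commute (X i j) (Y k l)) : IsQMatrix q (X * Y) := by
  intro i j k l
  simp only [Matrix.mul_apply, Finset.sum_mul_sum, Finset.smul_sum]
  rw [Finset.sum_comm]
  refine Finset.sum_congr rfl fun s _ => Finset.sum_congr rfl fun r _ => ?_
  calc X i r * Y r k * (X j s * Y s l)
      = X i r * X j s * (Y r k * Y s l) := by
        simp only [mul_assoc]; rw [← mul_assoc (Y r k), ← (h j s r k).eq, mul_assoc]
    _ = (mu q i j * mu q l k) • (X j s * X i r * (Y s l * Y r k)) := by
        rw [hX i j r s, hY r s k l, smul_mul_smul_comm]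
        congr 1
        have := mu_mul_mu q s r
        calc _ = (mu q s r * mu q r s) * (mu q i j * mu q l k) := by ac_rfl
          _ = _ := by rw [this, one_mul]
    _ = _ := by
        simp only [mul_assoc]; rw [← mul_assoc (X i r), (h i r s l).eq, mul_assoc]

theorem qdet_one : qdet q (1 : Matrix (Fin n) (Fin n) R) = 1 := by
  rw [qdet, Finset.sum_eq_single 1]
  · have h4 : detCoeff q (1 : Equiv.Perm (Fin n)) = 1 :=
      Finset.prod_eq_one fun i _ => Finset.prod_eq_one fun j hj => by
        simp [(Finset.mem_Ioi.mp hj).not_gt]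
    rw [h4, one_smul]
    refine List.prod_eq_one fun x hx => ?_
    obtain ⟨i, rfl⟩ := (List.mem_ofFn' _ _).mp hx
    exact Matrix.one_apply_eq i
  · intro σ _ hσ
    obtain ⟨i, hi⟩ : ∃ i, σ i ≠ i := by
      by_contra! hc
      exact hσ (Equiv.ext hc)
    rw [List.prod_eq_zero, smul_zero]
    rw [List.mem_ofFn']
    exact ⟨i, Matrix.one_apply_ne hi.symm⟩
  · simp

theorem IsQMatrix.one : IsQMatrix q (1 : Matrix (Fin n) (Fin n) R) := by
  intro i j k l
  by_cases h1 : i = k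
  · by_cases h2 : j = l
    · subst h1 h2; simp [mu_mul_mu]
    · simp [Matrix.one_apply_ne h2]
  · simp [Matrix.one_apply_ne h1]

/-! Invertibility of a `q`-matrix whose quantum determinant is invertible. -/

theorem listNorm_erase {ι : Type*} {c : ι → ι → Kˣ} {E : ι → R}
    (h : ∀ x y, c x y • (E x * E y) = c y x • (E y * E x)) (g : Fin n → ι) (j : Fin n) :
    listNorm c E (List.ofFn g) = listNorm c E (g j :: ((List.finRange n).erase j).map g) := by
  refine listNorm_perm h ?_
  rw [List.ofFn_eq_map, ← List.map_cons]
  exact (List.perm_cons_erase (List.mem_finRange j)).map g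

theorem map_erase_update {ι : Type*} (g g' : Fin n → ι) (j : Fin n) (h : ∀ i ≠ j, g i = g' i) :
    ((List.finRange n).erase j).map g = ((List.finRange n).erase j).map g' := by
  refine List.map_congr_left fun i hi => h i ?_
  exact ((List.Nodup.mem_erase_iff (List.nodup_finRange n)).mp hi).1

theorem exists_right_cofactor {M : Matrix (Fin n) (Fin n) R} (hM : IsQMatrix q M) :
    ∃ C : Matrix (Fin n) (Fin n) R, M * C = Matrix.diagonal fun _ => qdet q M := by
  classical
  let L (j : Fin n) := (List.finRange n).erase j
  refine ⟨Matrix.of fun k j => ∑ σ : Equiv.Perm (Fin n), if σ j = k then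
    (sg σ * listWt (pairWt q) ((j, σ j) :: (L j).map fun i => (i, σ i))) •
      ((L j).map fun i => M i (σ i)).prod else 0, ?_⟩
  ext i j
  have e1 : (M * Matrix.of fun k j => ∑ σ : Equiv.Perm (Fin n), if σ j = k then
      (sg σ * listWt (pairWt q) ((j, σ j) :: (L j).map fun i => (i, σ i))) •
      ((L j).map fun i => M i (σ i)).prod else 0) i j =
      ∑ σ : Equiv.Perm (Fin n),
        (sg σ * listWt (pairWt q) ((j, σ j) :: (L j).map fun i => (i, σ i))) •
          (M i (σ j) * ((L j).map fun i => M i (σ i)).prod) := by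
    simp only [Matrix.mul_apply, Matrix.of_apply, Finset.mul_sum]
    rw [Finset.sum_comm]
    refine Finset.sum_congr rfl fun σ _ => ?_
    simp only [mul_ite, mul_zero, Finset.sum_ite_eq, Finset.mem_univ, if_true]
    exact mul_smul_comm _ _ _
  rw [e1]
  rcases eq_or_ne i j with rfl | hij
  · rw [Matrix.diagonal_apply_eq, qdet_eq_altSum, altSum]
    refine Finset.sum_congr rfl fun σ _ => ?_
    rw [listNorm_erase hM.pair (fun i => (i, σ i)) i, listNorm, smul_smul]
    simp [L, Function.comp_def]
  · rw [Matrix.diagonal_apply_ne _ hij]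
    have h0 := altSum_eq_zero hM.pair (fun y k => (Function.update id j i y, k)) hij
      (by simp [Function.update_of_ne hij])
    let t : Kˣ := ((L j).map fun y => (chi q j y)⁻¹ * chi q i y).prod
    have h1 := congrArg (fun z => t • z) h0
    simp only [smul_zero, altSum, Finset.smul_sum] at h1
    rw [← h1]
    refine Finset.sum_congr rfl fun σ _ => ?_
    rw [listNorm_erase hM.pair _ j, listNorm,
      map_erase_update (fun y => (Function.update id j i y, σ y)) (fun y => (y, σ y)) j
        (fun y hy => by simp [Function.update_of_ne hy])]
    simp only [smul_smul, Function.update_self, List.map_cons, List.prod_cons, List.map_map,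
      listWt, Function.comp_def]
    congr 1
    have h2 : ((L j).map fun y => pairWt q (j, σ j) (y, σ y)).prod =
        t * ((L j).map fun y => pairWt q (i, σ j) (y, σ y)).prod := by
      rw [← List.prod_map_mul]
      congr 1
      refine List.map_congr_left fun y _ => ?_
      simp only [pairWt]
      calc _ = (chi q i y * (chi q i y)⁻¹) * ((chi q j y)⁻¹ * chi q (σ j) (σ y)) := by
            rw [mul_inv_cancel, one_mul]
        _ = _ := by ac_rfl
    rw [h2]
    ac_rfl

theorem altSum_swap {M : Matrix (Fin n) (Fin n) R} (hM : IsQMatrix q M) :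
    altSum (pairWt q) (fun x => M x.1 x.2) (fun i k => (k, i)) = qdet q M := by
  rw [qdet_eq_altSum]
  unfold altSum
  refine Fintype.sum_equiv (Equiv.inv _) _ _ fun σ => ?_
  rw [Equiv.inv_apply, sg_inv]
  congr 1
  refine listNorm_perm hM.pair ?_
  have := Equiv.Perm.ofFn_comp_perm σ (fun i => (i, σ⁻¹ i))
  simpa [Function.comp_def] using this

theorem exists_left_cofactor {M : Matrix (Fin n) (Fin n) R} (hM : IsQMatrix q M) :
    ∃ C : Matrix (Fin n) (Fin n) R, C * M = Matrix.diagonal fun _ => qdet q M := by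
  classical
  let L (j : Fin n) := (List.finRange n).erase j
  refine ⟨Matrix.of fun k j => ∑ σ : Equiv.Perm (Fin n), if σ k = j then
    (sg σ * listWt (pairWt q) (((L k).map fun i => (σ i, i)) ++ [(σ k, k)])) •
      ((L k).map fun i => M (σ i) i).prod else 0, ?_⟩
  ext k l
  have e1 : ((Matrix.of fun k j => ∑ σ : Equiv.Perm (Fin n), if σ k = j then
    (sg σ * listWt (pairWt q) (((L k).map fun i => (σ i, i)) ++ [(σ k, k)])) •
      ((L k).map fun i => M (σ i) i).prod else 0) * M) k l =
      ∑ σ : Equiv.Perm (Fin n),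
        (sg σ * listWt (pairWt q) (((L k).map fun i => (σ i, i)) ++ [(σ k, k)])) •
          (((L k).map fun i => M (σ i) i).prod * M (σ k) l) := by
    simp only [Matrix.mul_apply, Matrix.of_apply, Finset.sum_mul]
    rw [Finset.sum_comm]
    refine Finset.sum_congr rfl fun σ _ => ?_
    simp only [ite_mul, zero_mul, Finset.sum_ite_eq, Finset.mem_univ, if_true]
    exact smul_mul_assoc _ _ _
  rw [e1]
  have hperm (g : Fin n → Fin n × Fin n) : listNorm (pairWt q) (fun x => M x.1 x.2) (List.ofFn g) =
      listNorm (pairWt q) (fun x => M x.1 x.2) ((L k).map g ++ [g k]) := by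
    rw [listNorm_erase hM.pair g k]
    exact listNorm_perm hM.pair (List.perm_append_singleton _ _).symm
  rcases eq_or_ne k l with rfl | hkl
  · rw [Matrix.diagonal_apply_eq, ← altSum_swap hM, altSum]
    refine Finset.sum_congr rfl fun σ _ => ?_
    rw [hperm (fun i => (σ i, i)), listNorm, smul_smul]
    simp [L, Function.comp_def]
  · rw [Matrix.diagonal_apply_ne _ hkl]
    have h0 := altSum_eq_zero hM.pair (fun y r => (r, Function.update id k l y)) hkl
      (by simp [Function.update_of_ne hkl.symm])
    let t : Kˣ := ((L k).map fun y => chi q y k * (chi q y l)⁻¹).prod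
    have h1 := congrArg (fun z => t • z) h0
    simp only [smul_zero, altSum, Finset.smul_sum] at h1
    rw [← h1]
    refine Finset.sum_congr rfl fun σ _ => ?_
    rw [hperm, listNorm,
      map_erase_update (fun y => (σ y, Function.update id k l y)) (fun y => (σ y, y)) k
        (fun y hy => by simp [Function.update_of_ne hy])]
    simp only [smul_smul, Function.update_self, List.map_append, List.prod_append, List.map_cons,
      List.map_nil, List.prod_singleton, List.map_map, listWt_append_singleton, Function.comp_def]
    congr 1
    have h2 : ((L k).map fun y => pairWt q (σ y, y) (σ k, k)).prod =
        t * ((L k).map fun y => pairWt q (σ y, y) (σ k, l)).prod := by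
      rw [← List.prod_map_mul]
      congr 1
      refine List.map_congr_left fun y _ => ?_
      simp only [pairWt]
      calc _ = (chi q y l * (chi q y l)⁻¹) * ((chi q (σ y) (σ k))⁻¹ * chi q y k) := by
            rw [mul_inv_cancel, one_mul]
        _ = _ := by ac_rfl
    rw [h2]
    ac_rfl

theorem IsQMatrix.isUnit {M : Matrix (Fin n) (Fin n) R} (hM : IsQMatrix q M) {d : R}
    (h1 : qdet q M * d = 1) (h2 : d * qdet q M = 1) : IsUnit M := by
  obtain ⟨C, hC⟩ := exists_right_cofactor hM
  obtain ⟨C', hC'⟩ := exists_left_cofactor hM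
  have r : M * (C * Matrix.diagonal fun _ => d) = 1 := by
    rw [← mul_assoc, hC, Matrix.diagonal_mul_diagonal, h1, Matrix.diagonal_one]
  have l : ((Matrix.diagonal fun _ => d) * C') * M = 1 := by
    rw [mul_assoc, hC', Matrix.diagonal_mul_diagonal, h2, Matrix.diagonal_one]
  exact isUnit_iff_exists.mpr ⟨_, r, by rwa [← left_inv_eq_right_inv l r]⟩

theorem inv_comm_of_comm {M Y : Matrix (Fin n) (Fin n) R} (hMY : M * Y = 1) (hYM : Y * M = 1)
    {x : R} {e f : Fin n → Kˣ} (h : ∀ i j, M i j * x = (e i * f j) • (x * M i j)) (i j : Fin n) :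
    Y i j * x = ((f i)⁻¹ * (e j)⁻¹) • (x * Y i j) := by
  have hMY' (a b) : ∑ k, M a k * Y k b = (1 : Matrix (Fin n) (Fin n) R) a b := by
    rw [← hMY, Matrix.mul_apply]
  have hYM' (a b) : ∑ k, Y a k * M k b = (1 : Matrix (Fin n) (Fin n) R) a b := by
    rw [← hYM, Matrix.mul_apply]
  have T1 : ∑ l, ∑ k, (f l)⁻¹ • (Y i k * (M k l * x) * Y l j) = (f i)⁻¹ • (x * Y i j) := by
    have key (l) : ∑ k, (f l)⁻¹ • (Y i k * (M k l * x) * Y l j) =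
        (f l)⁻¹ • ((1 : Matrix (Fin n) (Fin n) R) i l * (x * Y l j)) := by
      rw [← hYM' i l, Finset.sum_mul, Finset.smul_sum]
      simp only [mul_assoc]
    simp only [key]
    rw [Finset.sum_eq_single i]
    · simp
    · intro l _ hl; simp [Matrix.one_apply_ne hl.symm]
    · simp
  have T2 : ∑ l, ∑ k, (f l)⁻¹ • (Y i k * (M k l * x) * Y l j) = e j • (Y i j * x) := by
    rw [Finset.sum_comm]
    have key (k) : ∑ l, (f l)⁻¹ • (Y i k * (M k l * x) * Y l j) =
        e k • (Y i k * x * (1 : Matrix (Fin n) (Fin n) R) k j) := by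
      rw [← hMY' k j, Finset.mul_sum, Finset.smul_sum]
      refine Finset.sum_congr rfl fun l _ => ?_
      rw [h, mul_smul_comm, smul_mul_assoc, smul_smul]
      simp [mul_assoc]
    simp only [key]
    rw [Finset.sum_eq_single j]
    · simp
    · intro l _ hl; simp [Matrix.one_apply_ne hl]
    · simp
  have := congrArg (fun z => (e j)⁻¹ • z) (T2.symm.trans T1)
  simpa [smul_smul, mul_comm] using this

theorem IsQMatrix.inv_mul {M Y : Matrix (Fin n) (Fin n) R} (hM : IsQMatrix q M) (hMY : M * Y = 1)
    (hYM : Y * M = 1) (i j k l : Fin n) :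
    Y i j * M k l = (mu q i l * mu q k j) • (M k l * Y i j) := by
  have := inv_comm_of_comm hMY hYM (x := M k l) (e := fun i => mu q i k) (f := fun j => mu q l j)
    (fun i j => hM i k j l) i j
  simpa [mu_inv] using this

theorem IsQMatrix.op_inv {M Y : Matrix (Fin n) (Fin n) R} (hM : IsQMatrix q M) (hMY : M * Y = 1)
    (hYM : Y * M = 1) : IsQMatrix q (Y.map MulOpposite.op) := by
  have h (i j k l) : M i j * Y k l = (mu q l i * mu q j k) • (Y k l * M i j) := by
    rw [hM.inv_mul hMY hYM k l i j, smul_smul]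
    have : mu q l i * mu q j k * (mu q k j * mu q i l) = 1 := by
      calc _ = (mu q l i * mu q i l) * (mu q j k * mu q k j) := by ac_rfl
        _ = 1 := by simp [mu_mul_mu]
    rw [this, one_smul]
  intro i j k l
  have := inv_comm_of_comm hMY hYM (x := Y i k) (e := fun i => mu q k i) (f := fun j => mu q j i)
    (fun a b => h a b i k) j l
  simp only [mu_inv] at this
  simp only [Matrix.map_apply, ← MulOpposite.op_mul, this, MulOpposite.op_smul]

theorem qdet_op_inv_mul {M Y : Matrix (Fin n) (Fin n) R} (hM : IsQMatrix q M)
    (hYM : Y * M = 1) : (qdet q (Y.map MulOpposite.op)).unop * qdet q M = 1 := by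
  let fL : Rᵐᵒᵖ →ₐ[K] Rᵐᵒᵖ ⊗[K] R := Algebra.TensorProduct.includeLeft
  let fR : R →ₐ[K] Rᵐᵒᵖ ⊗[K] R := Algebra.TensorProduct.includeRight
  let m : Rᵐᵒᵖ ⊗[K] R →ₗ[K] R :=
    LinearMap.mul' K R ∘ₗ TensorProduct.map (MulOpposite.opLinearEquiv K).symm.toLinearMap .id
  let C := (Y.map MulOpposite.op).map fL * M.map fR
  have hC (i j) (z) : m (C i j * z) = (1 : Matrix (Fin n) (Fin n) R) i j * m z := by
    induction z with
    | zero => simp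
    | add x y hx hy => simp only [mul_add, map_add, hx, hy]
    | tmul x y =>
      have h1 : m (C i j * x ⊗ₜ y) = x.unop * (∑ k, Y i k * M k j) * y := by
        simp [C, m, fL, fR, Matrix.mul_apply, Finset.sum_mul, Finset.mul_sum, mul_assoc]
      rw [h1, ← Matrix.mul_apply, hYM]
      rcases eq_or_ne i j with rfl | hij
      · simp [m]
      · simp [Matrix.one_apply_ne hij]
  have hL (L : List (Fin n × Fin n)) : m (L.map fun x => C x.1 x.2).prod =
      (L.map fun x => (1 : Matrix (Fin n) (Fin n) R) x.1 x.2).prod := by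
    induction L with
    | nil => simp [m, Algebra.TensorProduct.one_def]
    | cons x L ih => rw [List.map_cons, List.prod_cons, hC, ih, List.map_cons, List.prod_cons]
  have h1 : m (qdet q C) = 1 := by
    have h2 : m (qdet q C) = qdet q (1 : Matrix (Fin n) (Fin n) R) := by
      simp only [qdet, map_sum, Units.smul_def, map_smul]
      refine Finset.sum_congr rfl fun σ _ => ?_
      have := hL (List.ofFn fun i => (i, σ i))
      simp only [List.map_ofFn, Function.comp_def] at this
      rw [this]
    rw [h2, qdet_one]
  have h3 : qdet q C = fL (qdet q (Y.map MulOpposite.op)) * fR (qdet q M) := by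
    rw [qdet_mul (hM.map fR), qdet_map, qdet_map]
    intro i j k l
    simp [fL, fR, Commute, SemiconjBy]
  rw [h3] at h1
  simpa [m, fL, fR] using h1

/-! The change of coordinates on the overlap of two charts, at the level of matrices. -/

/-- The matrix with the rows `ℓ` and `m` of `M` interchanged and rescaled: row `ℓ` becomes
`M ℓ 1 * v * (row m)` and row `m` becomes `M m 1 * u * (row ℓ)`, where `u` and `v` are the inverses
of the entries `M ℓ 1` and `M m 1` of the first column. -/
def chartChange [NeZero n] (M : Matrix (Fin n) (Fin n) R) (ℓ m : Fin n) (u v : R) :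
    Matrix (Fin n) (Fin n) R := fun i k =>
  if i = ℓ then M ℓ 0 * v * M m k else if i = m then M m 0 * u * M ℓ k else M i k

theorem IsQMatrix.mul_inv_entry {M : Matrix (Fin n) (Fin n) R} (hM : IsQMatrix q M) {ℓ r : Fin n}
    {u : R} (h1 : M ℓ r * u = 1) (h2 : u * M ℓ r = 1) (j k : Fin n) :
    M j k * u = (mu q ℓ j * mu q k r) • (u * M j k) := by
  have h := congrArg (fun z => u * z * u) (hM ℓ j r k)
  simp only [mul_smul_comm, smul_mul_assoc, ← mul_assoc, h2, one_mul] at h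
  rw [h]
  congr 1
  rw [mul_assoc, h1, mul_one]

section ChartChange

variable [NeZero n] {M : Matrix (Fin n) (Fin n) R} {ℓ m : Fin n} {u v : R}

theorem entry_mul_ratio (hM : IsQMatrix q M) (hv1 : M m 0 * v = 1) (hv2 : v * M m 0 = 1)
    (j k : Fin n) : M j k * (M ℓ 0 * v) = (mu q j ℓ * mu q m j) • (M ℓ 0 * v * M j k) := by
  rw [← mul_assoc, hM j ℓ k 0, smul_mul_assoc, mul_assoc, hM.mul_inv_entry hv1 hv2, mul_smul_comm,
    smul_smul, mul_assoc]
  congr 1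
  calc _ = (mu q 0 k * mu q k 0) * (mu q j ℓ * mu q m j) := by ac_rfl
    _ = _ := by rw [mu_mul_mu, one_mul]
  rw [mul_assoc]

theorem IsQMatrix.chartChange (hM : IsQMatrix q M)
    (hu1 : M ℓ 0 * u = 1) (hu2 : u * M ℓ 0 = 1) (hv1 : M m 0 * v = 1) (hv2 : v * M m 0 = 1) :
    IsQMatrix q (chartChange M ℓ m u v) := by
  let τ := Equiv.swap ℓ m
  let G : Fin n → R := fun i => if i = ℓ then M ℓ 0 * v else if i = m then M m 0 * u else 1
  have hG (i k) : QuantumGL.chartChange M ℓ m u v i k = G i * M (τ i) k := by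
    simp only [QuantumGL.chartChange, G, τ]
    split_ifs with h1 h2
    · rw [h1, Equiv.swap_apply_left]
    · rw [h2, Equiv.swap_apply_right]
    · rw [Equiv.swap_apply_of_ne_of_ne h1 h2, one_mul]
  have hMG (j k i) : M j k * G i = (mu q j i * mu q (τ i) j) • (G i * M j k) := by
    simp only [G, τ]
    split_ifs with h1 h2
    · rw [h1, Equiv.swap_apply_left, entry_mul_ratio hM hv1 hv2]
    · rw [h2, Equiv.swap_apply_right, entry_mul_ratio hM hu1 hu2]
    · rw [Equiv.swap_apply_of_ne_of_ne h1 h2, mu_mul_mu, one_smul, one_mul, mul_one]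
  have hgh : M ℓ 0 * v * (M m 0 * u) = 1 := by
    rw [mul_assoc, ← mul_assoc v, hv2, one_mul, hu1]
  have hhg : M m 0 * u * (M ℓ 0 * v) = 1 := by
    rw [mul_assoc, ← mul_assoc u, hu2, one_mul, hv1]
  have hGG (i j) : G i * G j = G j * G i := by
    simp only [G]
    split_ifs <;> simp [hgh, hhg]
  have hmu (i j : Fin n) : mu q (τ i) j * mu q i (τ j) * mu q (τ j) (τ i) = mu q i j := by
    have hs (i : Fin n) : (i = ℓ ∧ τ i = m) ∨ (i = m ∧ τ i = ℓ) ∨ τ i = i := by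
      by_cases h1 : i = ℓ
      · exact Or.inl ⟨h1, by rw [h1]; exact Equiv.swap_apply_left _ _⟩
      · by_cases h2 : i = m
        · exact Or.inr (Or.inl ⟨h2, by rw [h2]; exact Equiv.swap_apply_right _ _⟩)
        · exact Or.inr (Or.inr (Equiv.swap_apply_of_ne_of_ne h1 h2))
    rcases hs i with ⟨hi, hi'⟩ | ⟨hi, hi'⟩ | hi <;> rcases hs j with ⟨hj, hj'⟩ | ⟨hj, hj'⟩ | hj
    · rw [hi', hj', hi, hj, mu_self, mu_self, mul_one, mu_mul_mu]
    · rw [hi', hj', hi, hj, mu_self, mu_self, one_mul, one_mul]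
    · rw [hi', hj, hi, mul_right_comm, mu_mul_mu, one_mul]
    · rw [hi', hj', hi, hj, mu_self, mu_self, one_mul, one_mul]
    · rw [hi', hj', hi, hj, mu_self, mu_self, mul_one, mu_mul_mu]
    · rw [hi', hj, hi, mul_right_comm, mu_mul_mu, one_mul]
    · rw [hi, hj', hj, mul_assoc, mu_mul_mu, mul_one]
    · rw [hi, hj', hj, mul_assoc, mu_mul_mu, mul_one]
    · rw [hi, hj, mul_assoc, mu_mul_mu, mul_one]
  intro i j k l
  have key (i j k l) : QuantumGL.chartChange M ℓ m u v i k * QuantumGL.chartChange M ℓ m u v j l =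
      (mu q (τ i) j * mu q (τ j) (τ i)) • (G i * G j * (M (τ i) k * M (τ j) l)) := by
    rw [hG, hG, mul_assoc, ← mul_assoc (M (τ i) k), hMG, smul_mul_assoc, mul_smul_comm]
    simp only [mul_assoc]
  rw [key, key j i, hGG j i, hM (τ i) (τ j) k l, mul_smul_comm, smul_smul, smul_smul]
  congr 1
  have e1 := mu_mul_mu q (τ j) (τ i)
  have e2 := mu_mul_mu q i (τ j)
  calc _ = mu q (τ i) j * (mu q (τ j) (τ i) * mu q (τ i) (τ j)) * mu q l k := by ac_rfl
    _ = mu q (τ i) j * mu q l k := by rw [e1, mul_one]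
    _ = mu q (τ i) j * (mu q i (τ j) * mu q (τ j) i) * (mu q (τ j) (τ i) * mu q (τ i) (τ j)) *
        mu q l k := by rw [e1, e2, mul_one, mul_one]
    _ = (mu q (τ i) j * mu q i (τ j) * mu q (τ j) (τ i)) * mu q l k *
        (mu q (τ j) i * mu q (τ i) (τ j)) := by ac_rfl
    _ = _ := by rw [hmu]

theorem qdet_chartChange (hM : IsQMatrix q M) (hℓm : ℓ ≠ m)
    (hu1 : M ℓ 0 * u = 1) (hu2 : u * M ℓ 0 = 1) (hv1 : M m 0 * v = 1) (hv2 : v * M m 0 = 1) :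
    qdet q (chartChange M ℓ m u v) = -qdet q M := by
  have hM' := hM.chartChange hu1 hu2 hv1 hv2
  let rest := ((List.finRange n).erase ℓ).erase m
  have hrest : (List.finRange n).Perm (ℓ :: m :: rest) := by
    refine (List.perm_cons_erase (List.mem_finRange ℓ)).trans (List.Perm.cons _ ?_)
    exact List.perm_cons_erase
      ((List.Nodup.mem_erase_iff (List.nodup_finRange n)).mpr ⟨hℓm.symm, List.mem_finRange m⟩)
  have hne (i) (hi : i ∈ rest) : i ≠ ℓ ∧ i ≠ m := by
    have h1 := (List.Nodup.mem_erase_iff ((List.nodup_finRange n).erase ℓ)).mp hi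
    exact ⟨((List.Nodup.mem_erase_iff (List.nodup_finRange n)).mp h1.2).1, h1.1⟩
  have hof {X : Matrix (Fin n) (Fin n) R} (hX : IsQMatrix q X) (g : Fin n → Fin n × Fin n) :
      listNorm (pairWt q) (fun x => X x.1 x.2) (List.ofFn g) =
        listNorm (pairWt q) (fun x => X x.1 x.2) (g ℓ :: g m :: rest.map g) := by
    refine listNorm_perm hX.pair ?_
    rw [List.ofFn_eq_map]
    exact hrest.map g
  have hterm (σ : Equiv.Perm (Fin n)) :
      listNorm (pairWt q) (fun x => QuantumGL.chartChange M ℓ m u v x.1 x.2)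
        (List.ofFn fun i => (i, σ i)) =
      listNorm (pairWt q) (fun x => M x.1 x.2)
        (List.ofFn fun i => (i, (σ * Equiv.swap ℓ m) i)) := by
    rw [hof hM', hof hM]
    have hg : rest.map (fun i => (i, σ (Equiv.swap ℓ m i))) = rest.map fun i => (i, σ i) := by
      refine List.map_congr_left fun i hi => ?_
      rw [Equiv.swap_apply_of_ne_of_ne (hne i hi).1 (hne i hi).2]
    have hP : (rest.map fun i => QuantumGL.chartChange M ℓ m u v i (σ i)).prod =
        (rest.map fun i => M i (σ i)).prod := by
      congr 1
      refine List.map_congr_left fun i hi => ?_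
      simp [QuantumGL.chartChange, (hne i hi).1, (hne i hi).2]
    have hcore (k l : Fin n) : QuantumGL.chartChange M ℓ m u v ℓ k *
        QuantumGL.chartChange M ℓ m u v m l = mu q l k • (M ℓ l * M m k) := by
      have e1 : QuantumGL.chartChange M ℓ m u v ℓ k = M ℓ 0 * v * M m k := by
        simp [QuantumGL.chartChange]
      have e2 : QuantumGL.chartChange M ℓ m u v m l = M m 0 * u * M ℓ l := by
        simp [QuantumGL.chartChange, hℓm.symm]
      rw [e1, e2, mul_assoc, ← mul_assoc (M m k), entry_mul_ratio hM hu1 hu2, smul_mul_assoc,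
        mul_smul_comm, mul_assoc (M m 0 * u), ← mul_assoc (M ℓ 0 * v)]
      have hgh : M ℓ 0 * v * (M m 0 * u) = 1 := by
        rw [mul_assoc, ← mul_assoc v, hv2, one_mul, hu1]
      rw [hgh, one_mul, hM m ℓ k l, smul_smul, mu_self, one_mul, ← mul_assoc, mu_mul_mu, one_mul]
    simp only [Equiv.Perm.mul_apply, Equiv.swap_apply_left, Equiv.swap_apply_right]
    rw [hg]
    simp only [listNorm, List.map_cons, List.prod_cons, List.map_map, Function.comp_def, listWt]
    rw [hP, ← mul_assoc (QuantumGL.chartChange M ℓ m u v ℓ (σ ℓ)), hcore, smul_mul_assoc, smul_smul,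
      mul_assoc (M ℓ (σ m))]
    congr 1
    have hw : (rest.map fun y => pairWt q (ℓ, σ ℓ) (y, σ y)).prod *
        (rest.map fun y => pairWt q (m, σ m) (y, σ y)).prod =
        (rest.map fun y => pairWt q (ℓ, σ m) (y, σ y)).prod *
        (rest.map fun y => pairWt q (m, σ ℓ) (y, σ y)).prod := by
      rw [← List.prod_map_mul, ← List.prod_map_mul]
      congr 1
      refine List.map_congr_left fun y _ => ?_
      simp only [pairWt]
      ac_rfl
    have hc : pairWt q (ℓ, σ ℓ) (m, σ m) * mu q (σ m) (σ ℓ) = pairWt q (ℓ, σ m) (m, σ ℓ) := by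
      simp only [pairWt]
      rw [← mu_mul_chi q (σ m) (σ ℓ)]
      ac_rfl
    calc _ = (pairWt q (ℓ, σ ℓ) (m, σ m) * mu q (σ m) (σ ℓ)) *
          ((rest.map fun y => pairWt q (ℓ, σ ℓ) (y, σ y)).prod *
            (rest.map fun y => pairWt q (m, σ m) (y, σ y)).prod) *
          listWt (pairWt q) (rest.map fun i => (i, σ i)) := by ac_rfl
      _ = _ := by rw [hw, hc]; ac_rfl
  rw [qdet_eq_altSum, qdet_eq_altSum, altSum, altSum, ← Finset.sum_neg_distrib]
  refine Fintype.sum_equiv (Equiv.mulRight (Equiv.swap ℓ m)) _ _ fun σ => ?_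
  rw [hterm, Equiv.coe_mulRight, sg_mul, sg_swap hℓm]
  simp [Units.smul_def]

end ChartChange

/-! Matrices with entries in a tensor product. -/

section TensorMatrix

variable {R' : Type*} [Ring R'] [Algebra K R']

/-- The matrix with entries `∑ k, X i k ⊗ Y k j`. -/
def tensorMul (X : Matrix (Fin n) (Fin n) R) (Y : Matrix (Fin n) (Fin n) R') :
    Matrix (Fin n) (Fin n) (R ⊗[K] R') :=
  Matrix.of fun i j => ∑ k, X i k ⊗ₜ[K] Y k j

theorem tensorMul_apply (X : Matrix (Fin n) (Fin n) R) (Y : Matrix (Fin n) (Fin n) R')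
    (i j : Fin n) : tensorMul (K := K) X Y i j = ∑ k, X i k ⊗ₜ[K] Y k j := rfl

theorem tensorMul_eq (X : Matrix (Fin n) (Fin n) R) (Y : Matrix (Fin n) (Fin n) R') :
    tensorMul (K := K) X Y =
      X.map (Algebra.TensorProduct.includeLeft : R →ₐ[K] R ⊗[K] R') *
        Y.map (Algebra.TensorProduct.includeRight : R' →ₐ[K] R ⊗[K] R') := by
  ext i j
  simp [tensorMul, Matrix.mul_apply]

theorem isQMatrix_tensorMul {X : Matrix (Fin n) (Fin n) R} {Y : Matrix (Fin n) (Fin n) R'}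
    (hX : IsQMatrix q X) (hY : IsQMatrix q Y) : IsQMatrix q (tensorMul (K := K) X Y) := by
  rw [tensorMul_eq]
  exact (hX.map _).mul (hY.map _) fun i j k l => by simp [Commute, SemiconjBy]

theorem qdet_tensorMul {X : Matrix (Fin n) (Fin n) R} {Y : Matrix (Fin n) (Fin n) R'}
    (hY : IsQMatrix q Y) : qdet q (tensorMul (K := K) X Y) = qdet q X ⊗ₜ qdet q Y := by
  rw [tensorMul_eq, qdet_mul (hY.map _) fun i j k l => by simp [Commute, SemiconjBy],
    qdet_map, qdet_map]
  simp

end TensorMatrix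

end QuantumDeterminant

noncomputable section Algebras

variable {K : Type*} [Field K] {n : ℕ} [NeZero n]

/-! The index `1` of the generators `a_{ij}` is the element `0 : Fin n`. -/

/-! ### The Takhtajan-Sudbery algebra and its localizations -/

/-- Generators: the entries `a i j`, the inverse of the quantum determinant, and the inverses of the
elements `a ℓ 1` for `ℓ ∈ S`. -/
inductive Gen (n : ℕ) (S : Set (Fin n)) : Type
  | a (i j : Fin n) : Gen n S
  | detInv : Gen n S
  | aInv (ℓ : S) : Gen n S

def freeMatrix (K : Type*) [Field K] (S : Set (Fin n)) :
    Matrix (Fin n) (Fin n) (FreeAlgebra K (Gen n S)) :=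
  Matrix.of fun i j => FreeAlgebra.ι K (Gen.a i j)

/-- The defining relations of the algebra `A[a ℓ 1 ⁻¹, ℓ ∈ S]`. -/
inductive Rel (q : Kˣ) (S : Set (Fin n)) :
    FreeAlgebra K (Gen n S) → FreeAlgebra K (Gen n S) → Prop
  | comm (i j k l : Fin n) : Rel q S (freeMatrix K S i k * freeMatrix K S j l)
      ((mu q i j * mu q l k) • (freeMatrix K S j l * freeMatrix K S i k))
  | det_mul : Rel q S (qdet q (freeMatrix K S) * FreeAlgebra.ι K Gen.detInv) 1
  | mul_det : Rel q S (FreeAlgebra.ι K Gen.detInv * qdet q (freeMatrix K S)) 1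
  | a_mul (ℓ : S) : Rel q S (freeMatrix K S ℓ 0 * FreeAlgebra.ι K (Gen.aInv ℓ)) 1
  | mul_a (ℓ : S) : Rel q S (FreeAlgebra.ι K (Gen.aInv ℓ) * freeMatrix K S ℓ 0) 1

/-- The algebra `A[a ℓ 1 ⁻¹, ℓ ∈ S]`, for `A` the Takhtajan-Sudbery algebra (the case `S = ∅`). -/
def GLLoc (q : Kˣ) (S : Set (Fin n)) : Type _ := RingQuot (Rel q S)

instance (q : Kˣ) (S : Set (Fin n)) : Ring (GLLoc q S) := inferInstanceAs (Ring (RingQuot (Rel q S)))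

instance (q : Kˣ) (S : Set (Fin n)) : Algebra K (GLLoc q S) :=
  inferInstanceAs (Algebra K (RingQuot (Rel q S)))

namespace GLLoc

variable (q : Kˣ) (S : Set (Fin n))

def mk : FreeAlgebra K (Gen n S) →ₐ[K] GLLoc q S := RingQuot.mkAlgHom K (Rel q S)

/-- The matrix of generators `a i j`. -/
def a : Matrix (Fin n) (Fin n) (GLLoc q S) := (freeMatrix K S).map (mk q S)

/-- The generator `D⁻¹`, inverse of the quantum determinant `D`. -/
def detInv : GLLoc q S := mk q S (FreeAlgebra.ι K Gen.detInv)

/-- The generator `a ℓ 1 ⁻¹`. -/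
def aInv (ℓ : S) : GLLoc q S := mk q S (FreeAlgebra.ι K (Gen.aInv ℓ))

variable {q S}

theorem mk_rel {x y} (h : Rel q S x y) : mk q S x = mk q S y := RingQuot.mkAlgHom_rel K h

theorem isQMatrix : IsQMatrix q (a q S) := by
  intro i j k l
  have := mk_rel (Rel.comm (q := q) (S := S) i j k l)
  rw [map_mul, Units.smul_def, map_smul, map_mul] at this
  exact this

theorem qdet_mul_detInv : qdet q (a q S) * detInv q S = 1 := by
  rw [a, qdet_map, detInv, ← map_mul, mk_rel Rel.det_mul, map_one]

theorem detInv_mul_qdet : detInv q S * qdet q (a q S) = 1 := by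
  rw [a, qdet_map, detInv, ← map_mul, mk_rel Rel.mul_det, map_one]

theorem a_mul_aInv (ℓ : S) : a q S ℓ 0 * aInv q S ℓ = 1 := by
  rw [a, Matrix.map_apply, aInv, ← map_mul, mk_rel (Rel.a_mul ℓ), map_one]

theorem aInv_mul_a (ℓ : S) : aInv q S ℓ * a q S ℓ 0 = 1 := by
  rw [a, Matrix.map_apply, aInv, ← map_mul, mk_rel (Rel.mul_a ℓ), map_one]

section Lift

variable {R : Type*} [Ring R] [Algebra K R] {M : Matrix (Fin n) (Fin n) R} (hM : IsQMatrix q M)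
  {d : R} (h1 : qdet q M * d = 1) (h2 : d * qdet q M = 1)
  {x : S → R} (hx1 : ∀ ℓ : S, M ℓ 0 * x ℓ = 1) (hx2 : ∀ ℓ : S, x ℓ * M ℓ 0 = 1)

def freeLift (M : Matrix (Fin n) (Fin n) R) (d : R) (x : S → R) : Gen n S → R
  | Gen.a i j => M i j
  | Gen.detInv => d
  | Gen.aInv ℓ => x ℓ

/-- The universal property of `GLLoc`: the algebra map with `a i j ↦ M i j`, `D⁻¹ ↦ d` and
`a ℓ 1 ⁻¹ ↦ x ℓ`. -/
def lift : GLLoc q S →ₐ[K] R :=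
  RingQuot.liftAlgHom K ⟨FreeAlgebra.lift K (freeLift M d x), by
    have e : (freeMatrix K S).map (FreeAlgebra.lift K (freeLift M d x)) = M := by
      ext i j
      simp [freeMatrix, freeLift]
    have e' (i j) : FreeAlgebra.lift K (freeLift M d x) (freeMatrix K S i j) = M i j :=
      congrFun (congrFun e i) j
    have ed : FreeAlgebra.lift K (freeLift M d x) (qdet q (freeMatrix K S)) = qdet q M := by
      rw [← qdet_map, e]
    rintro _ _ (⟨i, j, k, l⟩ | _ | _ | ℓ | ℓ)
    · rw [map_mul, e', e', Units.smul_def, map_smul, map_mul, e', e', hM i j k l, Units.smul_def]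
    · rw [map_mul, ed, FreeAlgebra.lift_ι_apply, map_one]; exact h1
    · rw [map_mul, ed, FreeAlgebra.lift_ι_apply, map_one]; exact h2
    · rw [map_mul, e', FreeAlgebra.lift_ι_apply, map_one]; exact hx1 ℓ
    · rw [map_mul, e', FreeAlgebra.lift_ι_apply, map_one]; exact hx2 ℓ⟩

theorem lift_mk (y : FreeAlgebra K (Gen n S)) :
    lift hM h1 h2 hx1 hx2 (mk q S y) = FreeAlgebra.lift K (freeLift M d x) y :=
  RingQuot.liftAlgHom_mkAlgHom_apply K _ _ _

@[simp] theorem lift_a (i j : Fin n) : lift hM h1 h2 hx1 hx2 (a q S i j) = M i j := by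
  rw [a, Matrix.map_apply, lift_mk]; simp [freeMatrix, freeLift]

@[simp] theorem lift_detInv : lift hM h1 h2 hx1 hx2 (detInv q S) = d := by
  rw [detInv, lift_mk]; simp [freeLift]

@[simp] theorem lift_aInv (ℓ : S) : lift hM h1 h2 hx1 hx2 (aInv q S ℓ) = x ℓ := by
  rw [aInv, lift_mk]; simp [freeLift]

end Lift

/-- Algebra maps out of `GLLoc` are determined by their values on the generators `a i j`. -/
theorem algHom_ext {R : Type*} [Ring R] [Algebra K R] {f g : GLLoc q S →ₐ[K] R}
    (h : ∀ i j, f (a q S i j) = g (a q S i j)) : f = g := by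
  have hm : (a q S).map f = (a q S).map g := by ext i j; exact h i j
  refine RingQuot.ringQuot_ext' K _ _ (FreeAlgebra.hom_ext ?_)
  funext y
  rcases y with ⟨i, j⟩ | _ | ℓ
  · exact h i j
  · change f (detInv q S) = g (detInv q S)
    have e1 : f (detInv q S) * f (qdet q (a q S)) = 1 := by
      rw [← map_mul, detInv_mul_qdet, map_one]
    have e2 : f (qdet q (a q S)) * g (detInv q S) = 1 := by
      rw [← qdet_map, hm, qdet_map, ← map_mul, qdet_mul_detInv, map_one]
    exact left_inv_eq_right_inv e1 e2
  · change f (aInv q S ℓ) = g (aInv q S ℓ)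
    have e1 : f (aInv q S ℓ) * f (a q S ℓ 0) = 1 := by
      rw [← map_mul, aInv_mul_a, map_one]
    have e2 : f (a q S ℓ 0) * g (aInv q S ℓ) = 1 := by
      rw [h, ← map_mul, a_mul_aInv, map_one]
    exact left_inv_eq_right_inv e1 e2

end GLLoc

/-- The Takhtajan-Sudbery algebra `A`, the quantum general linear group. -/
abbrev QGL (q : Kˣ) (n : ℕ) [NeZero n] : Type _ := GLLoc q (∅ : Set (Fin n))

/-! ### The quantum parabolic subgroup `H` -/

/-- The relations `a s 1 = 0` for `s ≠ 1`. -/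
inductive ParabolicRel (q : Kˣ) (n : ℕ) [NeZero n] : QGL q n → QGL q n → Prop
  | zero (s : Fin n) (hs : s ≠ 0) : ParabolicRel q n (GLLoc.a q ∅ s 0) 0

/-- The quantum parabolic subgroup `H = A / (a s 1, s ≠ 1)`. -/
def Parabolic (q : Kˣ) (n : ℕ) [NeZero n] : Type _ := RingQuot (ParabolicRel q n)

instance (q : Kˣ) (n : ℕ) [NeZero n] : Ring (Parabolic q n) :=
  inferInstanceAs (Ring (RingQuot (ParabolicRel q n)))

instance (q : Kˣ) (n : ℕ) [NeZero n] : Algebra K (Parabolic q n) :=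
  inferInstanceAs (Algebra K (RingQuot (ParabolicRel q n)))

namespace Parabolic

/-- The quotient map `A → H`. -/
def pr (q : Kˣ) (n : ℕ) [NeZero n] : QGL q n →ₐ[K] Parabolic q n := RingQuot.mkAlgHom K (ParabolicRel q n)

/-- The matrix of the elements `p i j`, the images of the `a i j`. -/
def p (q : Kˣ) (n : ℕ) [NeZero n] : Matrix (Fin n) (Fin n) (Parabolic q n) := (GLLoc.a q ∅).map (pr q n)

/-- The image of `D⁻¹`. -/
def detInv (q : Kˣ) (n : ℕ) [NeZero n] : Parabolic q n := pr q n (GLLoc.detInv q ∅)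

variable {q : Kˣ}

theorem p_zero {s : Fin n} (hs : s ≠ 0) : p q n s 0 = 0 := by
  have : pr q n (GLLoc.a q ∅ s 0) = pr q n 0 := RingQuot.mkAlgHom_rel K (ParabolicRel.zero s hs)
  rwa [map_zero] at this

theorem isQMatrix : IsQMatrix q (p q n) := GLLoc.isQMatrix.map _

theorem qdet_mul_detInv : qdet q (p q n) * detInv q n = 1 := by
  rw [p, qdet_map, detInv, ← map_mul, GLLoc.qdet_mul_detInv, map_one]

theorem detInv_mul_qdet : detInv q n * qdet q (p q n) = 1 := by
  rw [p, qdet_map, detInv, ← map_mul, GLLoc.detInv_mul_qdet, map_one]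

section Lift

variable {R : Type*} [Ring R] [Algebra K R] {M : Matrix (Fin n) (Fin n) R} (hM : IsQMatrix q M)
  {d : R} (h1 : qdet q M * d = 1) (h2 : d * qdet q M = 1) (h0 : ∀ s : Fin n, s ≠ 0 → M s 0 = 0)

/-- The universal property of `H`: the algebra map with `p i j ↦ M i j` and `D⁻¹ ↦ d`. -/
def lift : Parabolic q n →ₐ[K] R :=
  RingQuot.liftAlgHom K ⟨GLLoc.lift (S := ∅) hM h1 h2 (x := fun ℓ => ℓ.2.elim)
    (fun ℓ => ℓ.2.elim) (fun ℓ => ℓ.2.elim), by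
      rintro _ _ ⟨s, hs⟩
      rw [GLLoc.lift_a, map_zero, h0 s hs]⟩

@[simp] theorem lift_p (i j : Fin n) : lift hM h1 h2 h0 (p q n i j) = M i j :=
  (RingQuot.liftAlgHom_mkAlgHom_apply K _ _ _).trans (GLLoc.lift_a _ _ _ _ _ _ _)

@[simp] theorem lift_detInv : lift hM h1 h2 h0 (detInv q n) = d :=
  (RingQuot.liftAlgHom_mkAlgHom_apply K _ _ _).trans (GLLoc.lift_detInv _ _ _ _ _)

end Lift

theorem algHom_ext {R : Type*} [Ring R] [Algebra K R] {f g : Parabolic q n →ₐ[K] R}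
    (h : ∀ i j, f (p q n i j) = g (p q n i j)) : f = g :=
  RingQuot.ringQuot_ext' K _ _ (GLLoc.algHom_ext h)

/-- The inverse of the matrix of the `p i j`. -/
def pInv (q : Kˣ) (n : ℕ) [NeZero n] : Matrix (Fin n) (Fin n) (Parabolic q n) :=
  ((isQMatrix.isUnit qdet_mul_detInv detInv_mul_qdet).unit⁻¹ :
    (Matrix (Fin n) (Fin n) (Parabolic q n))ˣ)

theorem p_mul_pInv : p q n * pInv q n = 1 :=
  (isQMatrix.isUnit qdet_mul_detInv detInv_mul_qdet).mul_val_inv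

theorem pInv_mul_p : pInv q n * p q n = 1 :=
  (isQMatrix.isUnit qdet_mul_detInv detInv_mul_qdet).val_inv_mul

theorem pInv_mul_p_col (s : Fin n) :
    pInv q n s 0 * p q n 0 0 = (1 : Matrix (Fin n) (Fin n) (Parabolic q n)) s 0 := by
  rw [← pInv_mul_p, Matrix.mul_apply, Finset.sum_eq_single 0]
  · intro k _ hk; rw [p_zero hk, mul_zero]
  · simp

/-- The invertible element `p 1 1` of `H`. -/
def pUnit (q : Kˣ) (n : ℕ) [NeZero n] : (Parabolic q n)ˣ where
  val := p q n 0 0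
  inv := pInv q n 0 0
  val_inv := by
    have := (isQMatrix (q := q) (n := n)).inv_mul p_mul_pInv pInv_mul_p (0 : Fin n) 0 0 0
    rw [mu_self, one_mul, one_smul] at this
    rw [← this, pInv_mul_p_col, Matrix.one_apply_eq]
  inv_val := by rw [pInv_mul_p_col, Matrix.one_apply_eq]

theorem pInv_zero {s : Fin n} (hs : s ≠ 0) : pInv q n s 0 = 0 := by
  have h := pInv_mul_p_col (q := q) s
  rw [Matrix.one_apply_ne hs] at h
  have h2 : pInv q n s 0 * (pUnit q n : Parabolic q n) = 0 := h
  simpa using h2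

/-- Every element is obtained from the `p i j` and the inverse of the determinant. -/
theorem adjoin_eq_top :
    Algebra.adjoin K (insert (detInv q n) (Set.range fun x : Fin n × Fin n => p q n x.1 x.2)) = ⊤ := by
  have hf : Function.Surjective ((pr q n).comp (GLLoc.mk q ∅)) :=
    (RingQuot.mkAlgHom_surjective K _).comp (RingQuot.mkAlgHom_surjective K _)
  rw [eq_top_iff, ← (AlgHom.range_eq_top _).mpr hf, ← Algebra.map_top,
    ← FreeAlgebra.adjoin_range_ι, AlgHom.map_adjoin]
  refine Algebra.adjoin_mono ?_
  rintro _ ⟨_, ⟨y, rfl⟩, rfl⟩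
  rcases y with ⟨i, j⟩ | _ | ℓ
  · exact Or.inr ⟨(i, j), rfl⟩
  · exact Or.inl rfl
  · exact ℓ.2.elim

end Parabolic

namespace Parabolic

/-! #### The Hopf algebra structure of `H` -/

variable {q : Kˣ}

/-- The comultiplication of `H`: `p i j ↦ ∑ k, p i k ⊗ p k j` and `D⁻¹ ↦ D⁻¹ ⊗ D⁻¹`. -/
def comulHom (q : Kˣ) (n : ℕ) [NeZero n] : Parabolic q n →ₐ[K] Parabolic q n ⊗[K] Parabolic q n :=
  lift (isQMatrix_tensorMul isQMatrix isQMatrix) (d := detInv q n ⊗ₜ detInv q n)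
    (by rw [qdet_tensorMul isQMatrix, Algebra.TensorProduct.tmul_mul_tmul, qdet_mul_detInv]; rfl)
    (by rw [qdet_tensorMul isQMatrix, Algebra.TensorProduct.tmul_mul_tmul, detInv_mul_qdet]; rfl)
    (fun s hs => by
      rw [tensorMul_apply]
      refine Finset.sum_eq_zero fun k _ => ?_
      by_cases hk : k = 0
      · rw [hk, p_zero hs, TensorProduct.zero_tmul]
      · rw [p_zero hk, TensorProduct.tmul_zero])

theorem comulHom_p (i j : Fin n) : comulHom q n (p q n i j) = ∑ k, p q n i k ⊗ₜ p q n k j :=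
  lift_p _ _ _ _ _ _

/-- The counit of `H`: `p i j ↦ δ i j` and `D⁻¹ ↦ 1`. -/
def counitHom (q : Kˣ) (n : ℕ) [NeZero n] : Parabolic q n →ₐ[K] K :=
  lift IsQMatrix.one (d := 1) (by rw [qdet_one, one_mul]) (by rw [qdet_one, one_mul])
    (fun _ hs => Matrix.one_apply_ne hs)

theorem counitHom_p (i j : Fin n) : counitHom q n (p q n i j) = (1 : Matrix (Fin n) (Fin n) K) i j :=
  lift_p _ _ _ _ _ _

instance : Bialgebra K (Parabolic q n) :=
  Bialgebra.ofAlgHom (comulHom q n) (counitHom q n)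
    (algHom_ext fun i j => by
      simp only [AlgHom.comp_apply, comulHom_p, map_sum, Algebra.TensorProduct.map_tmul,
        AlgHom.coe_id, id_eq, TensorProduct.sum_tmul, TensorProduct.tmul_sum]
      rw [Finset.sum_comm]
      rfl)
    (algHom_ext fun i j => by
      simp only [AlgHom.comp_apply, comulHom_p, map_sum, Algebra.TensorProduct.map_tmul,
        AlgHom.coe_id, id_eq, counitHom_p]
      rw [Finset.sum_eq_single i]
      · simp
      · intro k _ hk; rw [Matrix.one_apply_ne hk.symm, TensorProduct.zero_tmul]
      · simp)
    (algHom_ext fun i j => by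
      simp only [AlgHom.comp_apply, comulHom_p, map_sum, Algebra.TensorProduct.map_tmul,
        AlgHom.coe_id, id_eq, counitHom_p]
      rw [Finset.sum_eq_single j]
      · simp
      · intro k _ hk; rw [Matrix.one_apply_ne hk, TensorProduct.tmul_zero]
      · simp)

theorem comul_eq (x : Parabolic q n) : Coalgebra.comul (R := K) x = comulHom q n x := rfl

theorem counit_eq (x : Parabolic q n) : Coalgebra.counit (R := K) x = counitHom q n x := rfl

theorem qdet_op_pInv :
    qdet q ((pInv q n).map MulOpposite.op) = MulOpposite.op (detInv q n) := by
  apply MulOpposite.unop_injective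
  have h := qdet_op_inv_mul (q := q) isQMatrix (pInv_mul_p (q := q) (n := n))
  exact left_inv_eq_right_inv h qdet_mul_detInv

/-- The antipode of `H` as an algebra map to the opposite algebra: the matrix of the `p i j` is
sent to its inverse and `D⁻¹` to `D`. -/
def antipodeHom (q : Kˣ) (n : ℕ) [NeZero n] : Parabolic q n →ₐ[K] (Parabolic q n)ᵐᵒᵖ :=
  lift (isQMatrix.op_inv p_mul_pInv pInv_mul_p) (d := MulOpposite.op (qdet q (p q n)))
    (by rw [qdet_op_pInv, ← MulOpposite.op_mul, qdet_mul_detInv]; rfl)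
    (by rw [qdet_op_pInv, ← MulOpposite.op_mul, detInv_mul_qdet]; rfl)
    (fun s hs => by rw [Matrix.map_apply, pInv_zero hs, MulOpposite.op_zero])

theorem antipodeHom_p (i j : Fin n) : antipodeHom q n (p q n i j) = MulOpposite.op (pInv q n i j) :=
  lift_p _ _ _ _ _ _

theorem antipodeHom_detInv : antipodeHom q n (detInv q n) = MulOpposite.op (qdet q (p q n)) :=
  lift_detInv _ _ _ _

theorem comulHom_detInv : comulHom q n (detInv q n) = detInv q n ⊗ₜ detInv q n :=
  lift_detInv _ _ _ _

theorem counitHom_detInv : counitHom q n (detInv q n) = 1 :=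
  lift_detInv _ _ _ _

/-- Induction principle for properties that define a subalgebra. -/
theorem induction {P : Parabolic q n → Prop} (hp : ∀ i j, P (p q n i j)) (hd : P (detInv q n))
    (halg : ∀ c : K, P (algebraMap K _ c)) (hadd : ∀ x y, P x → P y → P (x + y))
    (hmul : ∀ x y, P x → P y → P (x * y)) (x : Parabolic q n) : P x := by
  have hx : x ∈ Algebra.adjoin K
      (insert (detInv q n) (Set.range fun x : Fin n × Fin n => p q n x.1 x.2)) := by
    rw [adjoin_eq_top]; trivial
  induction hx using Algebra.adjoin_induction with
  | mem y hy =>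
    rcases hy with rfl | ⟨z, rfl⟩
    · exact hd
    · exact hp _ _
  | algebraMap c => exact halg c
  | add x y _ _ hx hy => exact hadd x y hx hy
  | mul x y _ _ hx hy => exact hmul x y hx hy

/-- The antipode of `H`. -/
def antipodeLin (q : Kˣ) (n : ℕ) [NeZero n] : Parabolic q n →ₗ[K] Parabolic q n :=
  (MulOpposite.opLinearEquiv K).symm.toLinearMap ∘ₗ (antipodeHom q n).toLinearMap

theorem antipode_left_aux (x : Parabolic q n) (z : (Parabolic q n)ᵐᵒᵖ ⊗[K] Parabolic q n) :
    (LinearMap.mul' K (Parabolic q n) ∘ₗ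
      TensorProduct.map (MulOpposite.opLinearEquiv K).symm.toLinearMap .id)
      (Algebra.TensorProduct.map (antipodeHom q n) (.id K _) (comulHom q n x) * z) =
    counitHom q n x • (LinearMap.mul' K (Parabolic q n) ∘ₗ
      TensorProduct.map (MulOpposite.opLinearEquiv K).symm.toLinearMap .id) z := by
  induction x using induction generalizing z with
  | hp i j =>
    induction z with
    | zero => simp
    | add x y hx hy => simp only [mul_add, map_add, smul_add, hx, hy]
    | tmul x y =>
      have h : ∑ k, pInv q n i k * p q n k j = (1 : Matrix _ _ (Parabolic q n)) i j := by
        rw [← pInv_mul_p, Matrix.mul_apply]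
      have h1 : (LinearMap.mul' K (Parabolic q n) ∘ₗ
          TensorProduct.map (MulOpposite.opLinearEquiv K).symm.toLinearMap .id)
          (Algebra.TensorProduct.map (antipodeHom q n) (.id K _) (comulHom q n (p q n i j)) *
            x ⊗ₜ y) = x.unop * (∑ k, pInv q n i k * p q n k j) * y := by
        simp [comulHom_p, antipodeHom_p, Finset.sum_mul, Finset.mul_sum, mul_assoc]
      rw [h1, h, counitHom_p]
      rcases eq_or_ne i j with rfl | hij
      · simp
      · simp [Matrix.one_apply_ne hij]
  | hd =>
    induction z with
    | zero => simp
    | add x y hx hy => simp only [mul_add, map_add, smul_add, hx, hy]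
    | tmul x y =>
      have h := qdet_mul_detInv (q := q) (n := n)
      simp only [comulHom_detInv, antipodeHom_detInv, counitHom_detInv,
        Algebra.TensorProduct.map_tmul, Algebra.TensorProduct.tmul_mul_tmul, LinearMap.comp_apply,
        TensorProduct.map_tmul, LinearMap.mul'_apply, one_smul]
      simp [mul_assoc]
      rw [← mul_assoc (qdet q (p q n)), h, one_mul]
  | halg c =>
    rw [AlgHom.commutes, AlgHom.commutes, AlgHom.commutes, ← Algebra.smul_def, map_smul]
    rfl
  | hadd x y hx hy => simp only [map_add, add_mul, add_smul, hx, hy]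
  | hmul x y hx hy =>
    rw [map_mul (comulHom q n), map_mul (Algebra.TensorProduct.map _ _), mul_assoc, hx, hy,
      map_mul (counitHom q n), mul_smul]

theorem antipode_right_aux (x : Parabolic q n) (z : Parabolic q n ⊗[K] (Parabolic q n)ᵐᵒᵖ) :
    (LinearMap.mul' K (Parabolic q n) ∘ₗ
      TensorProduct.map .id (MulOpposite.opLinearEquiv K).symm.toLinearMap)
      (z * Algebra.TensorProduct.map (.id K _) (antipodeHom q n) (comulHom q n x)) =
    counitHom q n x • (LinearMap.mul' K (Parabolic q n) ∘ₗ
      TensorProduct.map .id (MulOpposite.opLinearEquiv K).symm.toLinearMap) z := by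
  induction x using induction generalizing z with
  | hp i j =>
    induction z with
    | zero => simp
    | add x y hx hy => simp only [add_mul, map_add, smul_add, hx, hy]
    | tmul x y =>
      have h : ∑ k, p q n i k * pInv q n k j = (1 : Matrix _ _ (Parabolic q n)) i j := by
        rw [← p_mul_pInv, Matrix.mul_apply]
      have h1 : (LinearMap.mul' K (Parabolic q n) ∘ₗ
          TensorProduct.map .id (MulOpposite.opLinearEquiv K).symm.toLinearMap)
          (x ⊗ₜ y * Algebra.TensorProduct.map (.id K _) (antipodeHom q n)
            (comulHom q n (p q n i j))) = x * (∑ k, p q n i k * pInv q n k j) * y.unop := by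
        simp [comulHom_p, antipodeHom_p, Finset.sum_mul, Finset.mul_sum, mul_assoc]
      rw [h1, h, counitHom_p]
      rcases eq_or_ne i j with rfl | hij
      · simp
      · simp [Matrix.one_apply_ne hij]
  | hd =>
    induction z with
    | zero => simp
    | add x y hx hy => simp only [add_mul, map_add, smul_add, hx, hy]
    | tmul x y =>
      have h := detInv_mul_qdet (q := q) (n := n)
      simp only [comulHom_detInv, antipodeHom_detInv, counitHom_detInv,
        Algebra.TensorProduct.map_tmul, Algebra.TensorProduct.tmul_mul_tmul, LinearMap.comp_apply,
        TensorProduct.map_tmul, LinearMap.mul'_apply, one_smul]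
      simp [mul_assoc]
      rw [← mul_assoc (detInv q n), h, one_mul]
  | halg c =>
    rw [AlgHom.commutes, AlgHom.commutes, AlgHom.commutes, ← Algebra.commutes, ← Algebra.smul_def,
      map_smul]
    rfl
  | hadd x y hx hy => simp only [map_add, mul_add, add_smul, hx, hy]
  | hmul x y hx hy =>
    rw [map_mul (comulHom q n), map_mul (Algebra.TensorProduct.map _ _), ← mul_assoc, hy, hx,
      map_mul (counitHom q n), mul_comm (counitHom q n x), mul_smul]

/-- The Hopf algebra `H`. -/
instance : HopfAlgebra K (Parabolic q n) where
  antipode := antipodeLin q n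
  mul_antipode_rTensor_comul := by
    refine LinearMap.ext fun x => ?_
    have h := antipode_left_aux x 1
    rw [mul_one] at h
    have e : (LinearMap.mul' K (Parabolic q n) ∘ₗ
        TensorProduct.map (MulOpposite.opLinearEquiv K).symm.toLinearMap .id)
        (Algebra.TensorProduct.map (antipodeHom q n) (.id K _) (comulHom q n x)) =
        LinearMap.mul' K _ ((antipodeLin q n).rTensor _ (comulHom q n x)) := by
      induction comulHom q n x with
      | zero => simp
      | add x y hx hy => simp only [map_add, hx, hy]
      | tmul x y => rfl
    rw [e] at h
    simp only [LinearMap.comp_apply, comul_eq, counit_eq, Algebra.linearMap_apply]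
    rw [h]
    simp [Algebra.TensorProduct.one_def, Algebra.smul_def]
  mul_antipode_lTensor_comul := by
    refine LinearMap.ext fun x => ?_
    have h := antipode_right_aux x 1
    rw [one_mul] at h
    have e : (LinearMap.mul' K (Parabolic q n) ∘ₗ
        TensorProduct.map .id (MulOpposite.opLinearEquiv K).symm.toLinearMap)
        (Algebra.TensorProduct.map (.id K _) (antipodeHom q n) (comulHom q n x)) =
        LinearMap.mul' K _ ((antipodeLin q n).lTensor _ (comulHom q n x)) := by
      induction comulHom q n x with
      | zero => simp
      | add x y hx hy => simp only [map_add, hx, hy]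
      | tmul x y => rfl
    rw [e] at h
    simp only [LinearMap.comp_apply, comul_eq, counit_eq, Algebra.linearMap_apply]
    rw [h]
    simp [Algebra.TensorProduct.one_def, Algebra.smul_def]

end Parabolic

/-! ### The Levi quotient `H₀`, the coinvariants in `H` and the elements `β s` -/

namespace Parabolic

variable {q : Kˣ}

/-- The relations `p 1 s = 0` for `s ≠ 1`. -/
inductive LeviRel (q : Kˣ) (n : ℕ) [NeZero n] : Parabolic q n → Parabolic q n → Prop
  | zero (s : Fin n) (hs : s ≠ 0) : LeviRel q n (p q n 0 s) 0

/-- The quotient map `H → H₀`, where `H₀ = H / (p 1 s, s ≠ 1)`. -/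
def prLevi (q : Kˣ) (n : ℕ) [NeZero n] : Parabolic q n →ₐ[K] RingQuot (LeviRel q n) :=
  RingQuot.mkAlgHom K (LeviRel q n)

/-- The left coaction `(pr₀ ⊗ id) ∘ Δ` of `H₀` on `H`. -/
def leviCoaction (q : Kˣ) (n : ℕ) [NeZero n] :
    Parabolic q n →ₐ[K] RingQuot (LeviRel q n) ⊗[K] Parabolic q n :=
  (Algebra.TensorProduct.map (prLevi q n) (.id K _)).comp (Bialgebra.comulAlgHom K _)

/-- The subalgebra `{k ∈ H | pr₀(k₁) ⊗ k₂ = 1 ⊗ k}` of left `H₀`-coinvariants of `H`. -/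
def leviCoinv (q : Kˣ) (n : ℕ) [NeZero n] : Subalgebra K (Parabolic q n) :=
  AlgHom.equalizer (leviCoaction q n) Algebra.TensorProduct.includeRight

theorem leviCoaction_p (s : Fin n) :
    leviCoaction q n (p q n 0 s) = prLevi q n (p q n 0 0) ⊗ₜ p q n 0 s := by
  have h0 {k : Fin n} (hk : k ≠ 0) : prLevi q n (p q n 0 k) = 0 := by
    have : prLevi q n (p q n 0 k) = prLevi q n 0 := RingQuot.mkAlgHom_rel K (LeviRel.zero k hk)
    rwa [map_zero] at this
  have h1 : leviCoaction q n (p q n 0 s) = ∑ k, prLevi q n (p q n 0 k) ⊗ₜ p q n k s := by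
    rw [leviCoaction, AlgHom.comp_apply, Bialgebra.comulAlgHom_apply, comul_eq, comulHom_p, map_sum]
    rfl
  rw [h1, Finset.sum_eq_single 0]
  · intro k _ hk; rw [h0 hk, TensorProduct.zero_tmul]
  · simp

theorem beta_mem (s : Fin n) : (↑(pUnit q n)⁻¹ : Parabolic q n) * p q n 0 s ∈ leviCoinv q n := by
  change leviCoaction q n _ = 1 ⊗ₜ _
  have hu : IsUnit (leviCoaction q n (p q n 0 0)) := (pUnit q n).isUnit.map (leviCoaction q n)
  refine hu.mul_left_cancel ?_
  rw [← map_mul, ← mul_assoc]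
  have h1 : p q n 0 0 * (↑(pUnit q n)⁻¹ : Parabolic q n) = 1 := (pUnit q n).mul_inv
  rw [h1, one_mul, leviCoaction_p, leviCoaction_p, Algebra.TensorProduct.tmul_mul_tmul, mul_one,
    ← mul_assoc, h1, one_mul]

/-- The element `β s = p 1 1 ⁻¹ * p 1 s` of the algebra of coinvariants. -/
def beta (q : Kˣ) (s : Fin n) : leviCoinv q n :=
  ⟨(↑(pUnit q n)⁻¹ : Parabolic q n) * p q n 0 s, beta_mem s⟩

end Parabolic

/-! ### The charts `A_ℓ`, their coactions, and the elements `a ℓ 1 ⁻¹ * a ℓ s` -/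

/-- The right `H`-coaction on `A[a ℓ 1 ⁻¹, ℓ ∈ S]`: the algebra map with
`a i j ↦ ∑ k, a i k ⊗ p k j`, `D⁻¹ ↦ D⁻¹ ⊗ D⁻¹` and `a ℓ 1 ⁻¹ ↦ a ℓ 1 ⁻¹ ⊗ p 1 1 ⁻¹`. -/
def coaction (q : Kˣ) (S : Set (Fin n)) : GLLoc q S →ₐ[K] GLLoc q S ⊗[K] Parabolic q n :=
  have h (i : Fin n) : tensorMul (K := K) (GLLoc.a q S) (Parabolic.p q n) i 0 =
      GLLoc.a q S i 0 ⊗ₜ (Parabolic.pUnit q n : Parabolic q n) := by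
    rw [tensorMul_apply, Finset.sum_eq_single 0]
    · rfl
    · intro k _ hk; rw [Parabolic.p_zero hk, TensorProduct.tmul_zero]
    · simp
  GLLoc.lift (isQMatrix_tensorMul GLLoc.isQMatrix Parabolic.isQMatrix)
    (d := GLLoc.detInv q S ⊗ₜ Parabolic.detInv q n)
    (x := fun ℓ => GLLoc.aInv q S ℓ ⊗ₜ (↑(Parabolic.pUnit q n)⁻¹ : Parabolic q n))
    (by rw [qdet_tensorMul Parabolic.isQMatrix, Algebra.TensorProduct.tmul_mul_tmul,
          GLLoc.qdet_mul_detInv, Parabolic.qdet_mul_detInv]; rfl)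
    (by rw [qdet_tensorMul Parabolic.isQMatrix, Algebra.TensorProduct.tmul_mul_tmul,
          GLLoc.detInv_mul_qdet, Parabolic.detInv_mul_qdet]; rfl)
    (fun ℓ => by
      rw [h, Algebra.TensorProduct.tmul_mul_tmul, GLLoc.a_mul_aInv, Units.mul_inv]; rfl)
    (fun ℓ => by
      rw [h, Algebra.TensorProduct.tmul_mul_tmul, GLLoc.aInv_mul_a, Units.inv_mul]; rfl)

/-- The chart `A_ℓ = A[a ℓ 1 ⁻¹]`. -/
abbrev Chart (q : Kˣ) (ℓ : Fin n) : Type _ := GLLoc q ({ℓ} : Set (Fin n))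

/-- The element `a ℓ 1 ⁻¹ * a ℓ s` of `A_ℓ`. -/
def nu (q : Kˣ) (ℓ s : Fin n) : Chart q ℓ :=
  GLLoc.aInv q {ℓ} ⟨ℓ, rfl⟩ * GLLoc.a q {ℓ} ℓ s

/-! ### Overlaps and restriction maps -/

/-- The algebra `A_{ℓm} = A[a ℓ 1 ⁻¹, a m 1 ⁻¹]` of the overlap of two charts. -/
abbrev Overlap (q : Kˣ) (ℓ m : Fin n) : Type _ := GLLoc q ({ℓ, m} : Set (Fin n))

/-- The canonical map `A[a i 1 ⁻¹, i ∈ S] → A[a i 1 ⁻¹, i ∈ T]` for `S ⊆ T`. -/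
def localizationMap (q : Kˣ) {S T : Set (Fin n)} (h : S ⊆ T) : GLLoc q S →ₐ[K] GLLoc q T :=
  GLLoc.lift GLLoc.isQMatrix GLLoc.qdet_mul_detInv GLLoc.detInv_mul_qdet
    (x := fun ℓ => GLLoc.aInv q T ⟨ℓ, h ℓ.2⟩)
    (fun ℓ => GLLoc.a_mul_aInv ⟨ℓ, h ℓ.2⟩) (fun ℓ => GLLoc.aInv_mul_a ⟨ℓ, h ℓ.2⟩)

/-- The change of coordinates `Ψ : A_m[a ℓ 1 ⁻¹] → A_ℓ[a m 1 ⁻¹]`, the algebra map with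
`a ℓ k ↦ a ℓ 1 * a m 1 ⁻¹ * a m k`, `a m k ↦ a m 1 * a ℓ 1 ⁻¹ * a ℓ k`, `a j k ↦ a j k` for
`j ≠ ℓ, m`, `a ℓ 1 ⁻¹ ↦ a ℓ 1 ⁻¹`, `a m 1 ⁻¹ ↦ a m 1 ⁻¹` and `D⁻¹ ↦ - D⁻¹`.
The sign is forced, since the map interchanges two rows and hence sends `D` to `- D`. -/
def chartChangeHom (q : Kˣ) {ℓ m : Fin n} (h : ℓ ≠ m) : Overlap q ℓ m →ₐ[K] Overlap q ℓ m :=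
  let u : Overlap q ℓ m := GLLoc.aInv q {ℓ, m} ⟨ℓ, Or.inl rfl⟩
  let v : Overlap q ℓ m := GLLoc.aInv q {ℓ, m} ⟨m, Or.inr rfl⟩
  have hu1 : GLLoc.a q {ℓ, m} ℓ 0 * u = 1 := GLLoc.a_mul_aInv (S := {ℓ, m}) ⟨ℓ, Or.inl rfl⟩
  have hu2 : u * GLLoc.a q {ℓ, m} ℓ 0 = 1 := GLLoc.aInv_mul_a (S := {ℓ, m}) ⟨ℓ, Or.inl rfl⟩
  have hv1 : GLLoc.a q {ℓ, m} m 0 * v = 1 := GLLoc.a_mul_aInv (S := {ℓ, m}) ⟨m, Or.inr rfl⟩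
  have hv2 : v * GLLoc.a q {ℓ, m} m 0 = 1 := GLLoc.aInv_mul_a (S := {ℓ, m}) ⟨m, Or.inr rfl⟩
  have hq := qdet_chartChange (GLLoc.isQMatrix (q := q) (S := {ℓ, m})) h hu1 hu2 hv1 hv2
  have h0 (i : Fin n) : chartChange (GLLoc.a q {ℓ, m}) ℓ m u v i 0 = GLLoc.a q {ℓ, m} i 0 := by
    unfold chartChange
    split_ifs with h1 h2
    · rw [mul_assoc, hv2, mul_one, h1]
    · rw [mul_assoc, hu2, mul_one, h2]
    · rfl
  GLLoc.lift (GLLoc.isQMatrix.chartChange hu1 hu2 hv1 hv2)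
    (d := -GLLoc.detInv q {ℓ, m}) (x := GLLoc.aInv q {ℓ, m})
    (by rw [hq, neg_mul_neg, GLLoc.qdet_mul_detInv])
    (by rw [hq, neg_mul_neg, GLLoc.detInv_mul_qdet])
    (fun i => by rw [h0, GLLoc.a_mul_aInv])
    (fun i => by rw [h0, GLLoc.aInv_mul_a])

/-- The restriction map `ρ_{ℓ,ℓm} : A_ℓ → A_{ℓm}`. -/
def restrictLeft (q : Kˣ) (ℓ m : Fin n) : Chart q ℓ →ₐ[K] Overlap q ℓ m :=
  localizationMap q fun _ hi => Or.inl hi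

/-- The restriction map `ρ_{m,ℓm} : A_m → A_m[a ℓ 1 ⁻¹] → A_{ℓm}`, where the second map is the
change of coordinates. -/
def restrictRight (q : Kˣ) {ℓ m : Fin n} (h : ℓ ≠ m) : Chart q m →ₐ[K] Overlap q ℓ m :=
  (chartChangeHom q h).comp (localizationMap q fun _ hi => Or.inr hi)

end Algebras

noncomputable section HopfGalois

/-! ### Hopf-Galois extensions, the translation map and the Miyashita-Ulbrich action -/

variable {K : Type*} [Field K] {A H : Type*} [Ring A] [Algebra K A] [Ring H] [HopfAlgebra K H]

/-- The subalgebra of coinvariants `{b | δ b = b ⊗ 1}`. -/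
def coinvariants (δ : A →ₐ[K] A ⊗[K] H) : Subalgebra K A :=
  AlgHom.equalizer δ Algebra.TensorProduct.includeLeft

/-- The relations defining the tensor product over the subalgebra `B`. -/
def balancedRel (B : Subalgebra K A) : Submodule K (A ⊗[K] A) :=
  Submodule.span K {z | ∃ (x y : A) (b : B), z = (x * b) ⊗ₜ y - x ⊗ₜ (b * y)}

/-- The tensor product `A ⊗_B A`. -/
abbrev BalancedTensor (B : Subalgebra K A) : Type _ := (A ⊗[K] A) ⧸ balancedRel B

/-- The canonical map `A ⊗_B A → A ⊗ H`, `x ⊗ y ↦ x y₀ ⊗ y₁`, for `B` the coinvariants of `A`. -/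
def canonicalMap (δ : A →ₐ[K] A ⊗[K] H) : BalancedTensor (coinvariants δ) →ₗ[K] A ⊗[K] H :=
  (balancedRel (coinvariants δ)).liftQ
    (LinearMap.mul' K (A ⊗[K] H) ∘ₗ
      TensorProduct.map (Algebra.TensorProduct.includeLeft : A →ₐ[K] A ⊗[K] H).toLinearMap
        δ.toLinearMap) <| by
    rw [balancedRel, Submodule.span_le]
    rintro _ ⟨x, y, b, rfl⟩
    have hb : δ b = (b : A) ⊗ₜ 1 := b.2
    simp [hb, ← mul_assoc]

/-- The extension of the coinvariants by `A` is `H`-Galois: the canonical map is bijective. -/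
def IsHopfGalois (δ : A →ₐ[K] A ⊗[K] H) : Prop := Function.Bijective (canonicalMap δ)

/-- The translation map `h ↦ χ⁻¹ (1 ⊗ h)`, for `χ` the canonical map. -/
def translationMap {δ : A →ₐ[K] A ⊗[K] H} (hδ : IsHopfGalois δ) :
    H →ₗ[K] BalancedTensor (coinvariants δ) :=
  (LinearEquiv.ofBijective (canonicalMap δ) hδ).symm.toLinearMap ∘ₗ TensorProduct.mk K A H 1

/-- For `x` in the centralizer of `B`, the map `A ⊗_B A → A`, `y ⊗ z ↦ y x z`. -/
def sandwich {B : Subalgebra K A} (x : Subalgebra.centralizer K (B : Set A)) :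
    BalancedTensor B →ₗ[K] A :=
  (balancedRel B).liftQ (LinearMap.mul' K A ∘ₗ TensorProduct.map (LinearMap.mulRight K (x : A)) .id)
    <| by
    rw [balancedRel, Submodule.span_le]
    rintro _ ⟨y, z, b, rfl⟩
    have hx : (b : A) * x = x * b := Subalgebra.mem_centralizer_iff K |>.mp x.2 b b.2
    simp [mul_assoc]
    rw [← mul_assoc (b : A), hx, mul_assoc, sub_self]

/-- The Miyashita-Ulbrich action `x ◁ h = h⁽¹⁾ x h⁽²⁾`, where `h⁽¹⁾ ⊗ h⁽²⁾` is the image of `h` under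
the translation map. -/
def miyashitaUlbrich {δ : A →ₐ[K] A ⊗[K] H} (hδ : IsHopfGalois δ)
    (x : Subalgebra.centralizer K (coinvariants δ : Set A)) (h : H) : A :=
  sandwich x (translationMap hδ h)

/-- The right adjoint action `k ◁ h = S(h₁) k h₂` of a Hopf algebra on itself. -/
def rightAdjoint (k h : H) : H :=
  (LinearMap.mul' K H ∘ₗ TensorProduct.map (LinearMap.mulRight K k ∘ₗ HopfAlgebra.antipode K) .id)
    (Coalgebra.comul h)

end HopfGalois

end QuantumGL

/-! The scalar by which `β s` commutes with `p k j` is the scalar by which `a ℓ 1 ⁻¹ * a ℓ s`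
commutes with `a k j`. It depends on `s` and on the column `j`, but not on the row `k`
(`IsQMatrix.ratio_mul`). So a polynomial `k` in the `β s` moves past a generator by turning into a
polynomial `k'` with rescaled letters, and one `k'` serves both in `H` and, after applying `f`, in
the chart (`exists_twist`). Since `k'` does not see the row, it factors out of `S(h₁) k h₂` for a
generator `h`, leaving `S(h₁) h₂`, a scalar. This yields the commutation rule `f(k) y = y₀ f(S(y₁) k
y₂)` (`adjointPairing_coaction`).

The rule carries the first two properties. For coinvariant `y` it says that `f(k)` commutes with
`y`. Multiplied by `x` from the left, it says that `x f(k) y` depends only on `χ(x ⊗ y)`; evaluating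
at `χ⁻¹(1 ⊗ h)` identifies the Miyashita-Ulbrich action with the adjoint one (`map_rightAdjoint`).
Colinearity and agreement on overlaps are comparisons of values on the `β s`.

Such comparisons suffice because the `β s` generate the coinvariants
(`Parabolic.leviCoinv_eq_adjoin`): for the splitting `j : H₀ → H`, the map `h ↦ S(j(pr₀ h₁)) h₂`
fixes every coinvariant and takes values in the algebra generated by the `β s`. Uniqueness of `f`
follows. Existence needs no presentation of the coinvariants: `H` is represented on `A_ℓ` so that `β
s` acts as left multiplication by `a ℓ 1 ⁻¹ * a ℓ s` (`chartRep`), and `f(k)` is `k` applied to `1`.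

For the Galois property, the translation map should send `p i j` to `∑ k, Y i k ⊗ a k j`, with `Y`
the inverse of the matrix `a`. To have it well defined on `H`, let `A` act on `A_ℓ ⊗_{B_ℓ} A_ℓ` by
`v ↦ S(x₁) v x₂`. On the elements commuting with the `a m 1 * a ℓ 1 ⁻¹` this action descends to `H`
(`chartCentralAct_a_zero`), and the orbit map of `1 ⊗ 1` gives the inverse of `χ`. -/

namespace QuantumGL

/-! ### Commutation up to scalars, and its effect on quantum determinants. -/

noncomputable section ScalarCommutation

variable {K : Type*} [Field K] {n : ℕ} {q : Kˣ} {R : Type*} [Ring R] [Algebra K R]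

/-- The entries `u * M ℓ s` of a row divided by its first entry commute with `M k j` up to a scalar
that does not depend on the rows. -/
theorem IsQMatrix.ratio_mul [NeZero n] {M : Matrix (Fin n) (Fin n) R} (hM : IsQMatrix q M)
    {ℓ : Fin n} {u : R} (h1 : M ℓ 0 * u = 1) (h2 : u * M ℓ 0 = 1) (s k j : Fin n) :
    u * M ℓ s * M k j = (mu q j s * mu q 0 j) • (M k j * (u * M ℓ s)) := by
  rw [← mul_assoc, hM.mul_inv_entry h1 h2, mul_assoc, hM ℓ k s j, smul_mul_assoc, mul_smul_comm,
    smul_smul, mul_assoc]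
  congr 1
  calc mu q ℓ k * mu q j s = (mu q 0 j * mu q j 0) * (mu q ℓ k * mu q j s) := by
        rw [mu_mul_mu, one_mul]
    _ = _ := by ac_rfl
  rw [mul_assoc]

/-- The entries `M j 0 * u` of the first column divided by its `ℓ`-th entry commute with `M i k` up
to a scalar that does not depend on the columns. -/
theorem IsQMatrix.mul_colRatio [NeZero n] {M : Matrix (Fin n) (Fin n) R} (hM : IsQMatrix q M)
    {ℓ : Fin n} {u : R} (h1 : M ℓ 0 * u = 1) (h2 : u * M ℓ 0 = 1) (i j k : Fin n) :
    M i k * (M j 0 * u) = (mu q i j * mu q ℓ i) • (M j 0 * u * M i k) := by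
  rw [← mul_assoc, hM i j k 0, smul_mul_assoc, mul_assoc, hM.mul_inv_entry h1 h2, mul_smul_comm,
    smul_smul, mul_assoc]
  congr 1
  calc _ = (mu q 0 k * mu q k 0) * (mu q i j * mu q ℓ i) := by ac_rfl
    _ = _ := by rw [mu_mul_mu, one_mul]
  rw [mul_assoc]

theorem mul_prod_ofFn_smul {m : ℕ} {x : R} {g : Fin m → R} {e : Fin m → Kˣ}
    (h : ∀ i, x * g i = e i • (g i * x)) :
    x * (List.ofFn g).prod = (∏ i, e i) • ((List.ofFn g).prod * x) := by
  induction m with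
  | zero => simp
  | succ m ih =>
    rw [List.ofFn_succ, List.prod_cons, ← mul_assoc, h, smul_mul_assoc, mul_assoc,
      ih fun i => h i.succ, mul_smul_comm, smul_smul, Fin.prod_univ_succ, mul_assoc]

/-- Each monomial of the determinant meets every column exactly once, so all monomials pick up the
same scalar. The row version below holds for the same reason. -/
theorem mul_qdet_of_col {M : Matrix (Fin n) (Fin n) R} {x : R} {e : Fin n → Kˣ}
    (h : ∀ i j, x * M i j = e j • (M i j * x)) :
    x * qdet q M = (∏ j, e j) • (qdet q M * x) := by
  simp only [qdet, Finset.mul_sum, Finset.sum_mul, Finset.smul_sum]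
  refine Finset.sum_congr rfl fun σ _ => ?_
  rw [mul_smul_comm, mul_prod_ofFn_smul fun i => h i (σ i), Equiv.prod_comp σ e, smul_mul_assoc,
    smul_comm]

theorem mul_qdet_of_row {M : Matrix (Fin n) (Fin n) R} {x : R} {e : Fin n → Kˣ}
    (h : ∀ i j, x * M i j = e i • (M i j * x)) :
    x * qdet q M = (∏ j, e j) • (qdet q M * x) := by
  simp only [qdet, Finset.mul_sum, Finset.sum_mul, Finset.smul_sum]
  refine Finset.sum_congr rfl fun σ _ => ?_
  rw [mul_smul_comm, mul_prod_ofFn_smul fun i => h i (σ i), smul_mul_assoc, smul_comm]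

theorem mul_inv_smul {x y y' : R} {c : Kˣ} (h1 : y * y' = 1) (h2 : y' * y = 1)
    (h : x * y = c • (y * x)) : x * y' = c⁻¹ • (y' * x) := by
  have h3 := congrArg (fun z => c⁻¹ • (y' * z * y')) h
  simp only [mul_smul_comm, smul_mul_assoc, inv_smul_smul, mul_assoc, h1, mul_one] at h3
  rw [← mul_assoc y' y, h2, one_mul] at h3
  exact h3.symm

/-- An element of the subalgebra generated by `b` can be moved past the elements that commute up to
the scalars `e` with the images of the generators, at the cost of rescaling the generators. -/
theorem exists_twist {X Y₁ Y₂ ι : Type*} [Ring X] [Algebra K X] [Ring Y₁] [Algebra K Y₁]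
    [Ring Y₂] [Algebra K Y₂] (φ₁ : X →ₐ[K] Y₁) (φ₂ : X →ₐ[K] Y₂) {b : ι → X} (e : ι → Kˣ) {x : X}
    (hx : x ∈ Algebra.adjoin K (Set.range b)) :
    ∃ x' ∈ Algebra.adjoin K (Set.range b),
      (∀ y, (∀ t, φ₁ (b t) * y = e t • (y * φ₁ (b t))) → φ₁ x * y = y * φ₁ x') ∧
      (∀ y, (∀ t, φ₂ (b t) * y = e t • (y * φ₂ (b t))) → φ₂ x * y = y * φ₂ x') := by
  -- The witness `x'` is `x` with every letter `b t` replaced by `e t • b t`. Only its existence for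
  -- each single `x` is claimed, so it need not be checked that the rescaling defines an
  -- endomorphism.
  induction hx using Algebra.adjoin_induction with
  | mem x hx =>
    obtain ⟨t, rfl⟩ := hx
    refine ⟨(e t : K) • b t, Subalgebra.smul_mem _ (Algebra.subset_adjoin (Set.mem_range_self t)) _,
      fun y hy => ?_, fun y hy => ?_⟩
    · rw [hy, map_smul, mul_smul_comm]; rfl
    · rw [hy, map_smul, mul_smul_comm]; rfl
  | algebraMap c =>
    refine ⟨algebraMap K X c, Subalgebra.algebraMap_mem _ _, fun y _ => ?_, fun y _ => ?_⟩
    · rw [AlgHom.commutes, Algebra.commutes]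
    · rw [AlgHom.commutes, Algebra.commutes]
  | add x z _ _ hx hz =>
    obtain ⟨x', hx', h1, h2⟩ := hx
    obtain ⟨z', hz', h3, h4⟩ := hz
    refine ⟨x' + z', add_mem hx' hz', fun y hy => ?_, fun y hy => ?_⟩
    · rw [map_add, map_add, add_mul, mul_add, h1 y hy, h3 y hy]
    · rw [map_add, map_add, add_mul, mul_add, h2 y hy, h4 y hy]
  | mul x z _ _ hx hz =>
    obtain ⟨x', hx', h1, h2⟩ := hx
    obtain ⟨z', hz', h3, h4⟩ := hz
    refine ⟨x' * z', mul_mem hx' hz', fun y hy => ?_, fun y hy => ?_⟩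
    · rw [map_mul, map_mul, mul_assoc, h3 y hy, ← mul_assoc, h1 y hy, mul_assoc]
    · rw [map_mul, map_mul, mul_assoc, h4 y hy, ← mul_assoc, h2 y hy, mul_assoc]

theorem isQMatrix_diagonal (t : Fin n → K) : IsQMatrix q (Matrix.diagonal t) := by
  intro i j k l
  by_cases h1 : i = k
  · by_cases h2 : j = l
    · subst h1 h2; rw [mu_mul_mu, one_smul, mul_comm]
    · simp [Matrix.diagonal_apply_ne _ h2]
  · simp [Matrix.diagonal_apply_ne _ h1]

/-! Quantum determinants of matrices with many zero entries. -/

/-- A permutation that fixes every index but one is the identity, so only the diagonal monomial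
survives. -/
theorem qdet_of_zero_off_row [NeZero n] {M : Matrix (Fin n) (Fin n) R}
    (h : ∀ i j, i ≠ 0 → i ≠ j → M i j = 0) : qdet q M = (List.ofFn fun i => M i i).prod := by
  rw [qdet, Finset.sum_eq_single 1]
  · have h4 : detCoeff q (1 : Equiv.Perm (Fin n)) = 1 :=
      Finset.prod_eq_one fun i _ => Finset.prod_eq_one fun j hj => by
        simp [(Finset.mem_Ioi.mp hj).not_gt]
    rw [h4, one_smul]
    rfl
  · intro σ _ hσ
    obtain ⟨i, hi0, hi⟩ : ∃ i, i ≠ 0 ∧ σ i ≠ i := by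
      by_contra! hc
      refine hσ (Equiv.ext fun i => ?_)
      by_cases h0 : i = 0
      · subst h0
        by_contra h1
        exact h1 (σ.injective (hc _ h1))
      · exact hc i h0
    rw [List.prod_eq_zero, smul_zero]
    rw [List.mem_ofFn']
    exact ⟨i, h i _ hi0 hi.symm⟩
  · simp

/-- The matrix obtained from `M` by putting the entries of the first row off the diagonal to `0`. -/
def clearRow [NeZero n] (M : Matrix (Fin n) (Fin n) R) : Matrix (Fin n) (Fin n) R :=
  Matrix.of fun i j => if i = 0 ∧ j ≠ 0 then 0 else M i j

/-- Both sides of a defining relation contain the same two entries, so they vanish together when one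
of these entries is cleared. -/
theorem IsQMatrix.clearRow [NeZero n] {M : Matrix (Fin n) (Fin n) R} (hM : IsQMatrix q M) :
    IsQMatrix q (clearRow M) := by
  intro i j k l
  simp only [QuantumGL.clearRow, Matrix.of_apply]
  split_ifs
  · simp
  · simp
  · simp
  · exact hM i j k l

/-- Because the first column vanishes below the corner, only permutations fixing the first index
contribute, and their monomials do not contain the cleared entries. -/
theorem qdet_clearRow [NeZero n] {M : Matrix (Fin n) (Fin n) R} (h : ∀ i, i ≠ 0 → M i 0 = 0) :
    qdet q (clearRow M) = qdet q M := by
  unfold qdet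
  refine Finset.sum_congr rfl fun σ _ => ?_
  congr 1
  by_cases h0 : σ 0 = 0
  · congr 2
    funext i
    rw [clearRow, Matrix.of_apply, if_neg]
    rintro ⟨rfl, h1⟩
    exact h1 h0
  · rw [List.prod_eq_zero, List.prod_eq_zero]
    · rw [List.mem_ofFn']
      refine ⟨σ.symm 0, ?_⟩
      simp only [Equiv.apply_symm_apply]
      exact h _ fun h1 => h0 (σ.symm_apply_eq.mp h1).symm
    · rw [List.mem_ofFn']
      exact ⟨0, if_pos ⟨rfl, h0⟩⟩

/-- The map `x ⊗ y ↦ g(x) c y`, for an algebra map `g` to the opposite algebra. -/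
def opSandwich {X : Type*} [Ring X] [Algebra K X] (g : X →ₐ[K] Rᵐᵒᵖ) (c : R) :
    X ⊗[K] R →ₗ[K] R :=
  LinearMap.mul' K R ∘ₗ TensorProduct.map (LinearMap.mulRight K c ∘ₗ
    (MulOpposite.opLinearEquiv K).symm.toLinearMap ∘ₗ g.toLinearMap) .id

theorem opSandwich_tmul {X : Type*} [Ring X] [Algebra K X] (g : X →ₐ[K] Rᵐᵒᵖ) (c : R) (x : X)
    (y : R) : opSandwich g c (x ⊗ₜ y) = (g x).unop * c * y := rfl

/-- As `g` reverses products, sandwiches nest. Expressions such as `S(h₁) c h₂` thus form a right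
action in `h`, and can be studied on generators as long as `c` is kept arbitrary. -/
theorem opSandwich_mul {X : Type*} [Ring X] [Algebra K X] (g : X →ₐ[K] Rᵐᵒᵖ) (c : R)
    (w w' : X ⊗[K] R) : opSandwich g c (w * w') = opSandwich g (opSandwich g c w) w' := by
  induction w' with
  | zero => simp
  | add x y hx hy => simp only [mul_add, map_add, hx, hy]
  | tmul x' y' =>
    induction w with
    | zero => simp [opSandwich_tmul]
    | add x y hx hy =>
      simp only [add_mul, map_add, hx, hy]
      simp only [opSandwich_tmul, mul_add, add_mul]
    | tmul x y =>
      simp only [Algebra.TensorProduct.tmul_mul_tmul, opSandwich_tmul, map_mul,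
        MulOpposite.unop_mul, mul_assoc]

end ScalarCommutation

/-! ### Generators of the localized algebras. -/

section Induction

variable {K : Type*} [Field K] {n : ℕ} [NeZero n] {q : Kˣ} {S : Set (Fin n)}

theorem GLLoc.adjoin_eq_top :
    Algebra.adjoin K (Set.range fun y => GLLoc.mk q S (FreeAlgebra.ι K y)) = ⊤ := by
  have hf : Function.Surjective (GLLoc.mk q S) := RingQuot.mkAlgHom_surjective K _
  rw [eq_top_iff, ← (AlgHom.range_eq_top _).mpr hf, ← Algebra.map_top,
    ← FreeAlgebra.adjoin_range_ι, AlgHom.map_adjoin]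
  refine Algebra.adjoin_mono ?_
  rintro _ ⟨_, ⟨y, rfl⟩, rfl⟩
  exact ⟨y, rfl⟩

/-- Induction principle for properties that define a subalgebra. -/
theorem GLLoc.induction {P : GLLoc q S → Prop} (ha : ∀ i j, P (GLLoc.a q S i j))
    (hd : P (GLLoc.detInv q S)) (hi : ∀ ℓ : S, P (GLLoc.aInv q S ℓ))
    (halg : ∀ c : K, P (algebraMap K _ c)) (hadd : ∀ x y, P x → P y → P (x + y))
    (hmul : ∀ x y, P x → P y → P (x * y)) (x : GLLoc q S) : P x := by
  have hx : x ∈ Algebra.adjoin K (Set.range fun y => GLLoc.mk q S (FreeAlgebra.ι K y)) := by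
    rw [adjoin_eq_top]; trivial
  induction hx using Algebra.adjoin_induction with
  | mem y hy =>
    obtain ⟨y | _ | ℓ, rfl⟩ := hy
    · exact ha _ _
    · exact hd
    · exact hi ℓ
  | algebraMap c => exact halg c
  | add x y _ _ hx hy => exact hadd x y hx hy
  | mul x y _ _ hx hy => exact hmul x y hx hy

end Induction

/-! ### The coinvariants of `H` are generated by the `β s`. -/

noncomputable section LeviCoinvariants

variable {K : Type*} [Field K] {n : ℕ} [NeZero n] {q : Kˣ}

namespace Parabolic

theorem coe_beta (s : Fin n) :
    (beta q s : Parabolic q n) = (↑(pUnit q n)⁻¹ : Parabolic q n) * p q n 0 s := rfl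

theorem p_mul_pUnit_inv : p q n 0 0 * (↑(pUnit q n)⁻¹ : Parabolic q n) = 1 := (pUnit q n).mul_inv

theorem pUnit_inv_mul_p : (↑(pUnit q n)⁻¹ : Parabolic q n) * p q n 0 0 = 1 := (pUnit q n).inv_mul

theorem beta_zero : beta q (0 : Fin n) = 1 := Subtype.ext pUnit_inv_mul_p

/-- The absence of the row `k` from the scalar is what lets it leave sums such as `∑ k, S(p i k) * β
s * p k j`. -/
theorem beta_mul_p (s k j : Fin n) : (beta q s : Parabolic q n) * p q n k j =
    (mu q j s * mu q 0 j) • (p q n k j * beta q s) :=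
  isQMatrix.ratio_mul p_mul_pUnit_inv pUnit_inv_mul_p s k j

theorem beta_mul_detInv (s : Fin n) : (beta q s : Parabolic q n) * detInv q n =
    (∏ j, mu q j s * mu q 0 j)⁻¹ • (detInv q n * beta q s) :=
  mul_inv_smul qdet_mul_detInv detInv_mul_qdet (mul_qdet_of_col fun k j => beta_mul_p s k j)

/-- Algebra maps on `A` that vanish on the `a s 1` with `s ≠ 1` factor over `H`. -/
def descend {R : Type*} [Ring R] [Algebra K R] (g : QGL q n →ₐ[K] R)
    (h : ∀ s : Fin n, s ≠ 0 → g (GLLoc.a q ∅ s 0) = 0) : Parabolic q n →ₐ[K] R :=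
  RingQuot.liftAlgHom K ⟨g, by
    rintro _ _ ⟨s, hs⟩
    rw [h s hs, map_zero]⟩

theorem descend_pr {R : Type*} [Ring R] [Algebra K R] (g : QGL q n →ₐ[K] R)
    (h : ∀ s : Fin n, s ≠ 0 → g (GLLoc.a q ∅ s 0) = 0) (x : QGL q n) :
    descend g h (pr q n x) = g x :=
  RingQuot.liftAlgHom_mkAlgHom_apply K _ _ _

/-- The endomorphism `j ∘ pr₀` of `H`, for `j` the splitting of the quotient map `pr₀ : H → H₀`. -/
def splitHom (q : Kˣ) (n : ℕ) [NeZero n] : Parabolic q n →ₐ[K] Parabolic q n :=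
  lift (isQMatrix (q := q)).clearRow (d := detInv q n)
    (by rw [qdet_clearRow fun _ h => p_zero h, qdet_mul_detInv])
    (by rw [qdet_clearRow fun _ h => p_zero h, detInv_mul_qdet])
    (fun s hs => by simp [clearRow, hs, p_zero])

theorem splitHom_p (i j : Fin n) : splitHom q n (p q n i j) = clearRow (p q n) i j :=
  lift_p _ _ _ _ _ _

theorem splitHom_detInv : splitHom q n (detInv q n) = detInv q n := lift_detInv _ _ _ _

/-- The map `S ∘ j : H₀ → H` as an algebra map to the opposite algebra, for `j : H₀ → H` the
splitting of the quotient map. -/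
def leviAntipode (q : Kˣ) (n : ℕ) [NeZero n] :
    RingQuot (LeviRel q n) →ₐ[K] (Parabolic q n)ᵐᵒᵖ :=
  RingQuot.liftAlgHom K ⟨(antipodeHom q n).comp (splitHom q n), by
    rintro _ _ ⟨s, hs⟩
    rw [AlgHom.comp_apply, splitHom_p, map_zero]
    simp [clearRow, hs]⟩

theorem leviAntipode_prLevi (x : Parabolic q n) :
    leviAntipode q n (prLevi q n x) = antipodeHom q n (splitHom q n x) :=
  RingQuot.liftAlgHom_mkAlgHom_apply K _ _ _

/-- In the first row only `p 1 1` survives the splitting, leaving `p 1 1 ⁻¹ * p 1 j`; the other rows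
are untouched, and the sum is an entry of the inverse matrix times the matrix. -/
theorem sum_antipode_splitHom_mul_p (i j : Fin n) :
    ∑ k, (antipodeHom q n (splitHom q n (p q n i k))).unop * p q n k j =
      if i = 0 then (beta q j : Parabolic q n) else if i = j then 1 else 0 := by
  split_ifs with h0 hij
  · subst h0
    rw [Finset.sum_eq_single 0]
    · rw [splitHom_p, clearRow, Matrix.of_apply, if_neg (by simp), antipodeHom_p]
      rfl
    · intro k _ hk
      simp [splitHom_p, clearRow, hk]
    · simp
  · subst hij
    simp only [splitHom_p, clearRow, Matrix.of_apply, h0, false_and, if_false, antipodeHom_p,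
      MulOpposite.unop_op]
    rw [← Matrix.mul_apply, pInv_mul_p, Matrix.one_apply_eq]
  · simp only [splitHom_p, clearRow, Matrix.of_apply, h0, false_and, if_false, antipodeHom_p,
      MulOpposite.unop_op]
    rw [← Matrix.mul_apply, pInv_mul_p, Matrix.one_apply_ne hij]

/-- The expression is `S(j(pr₀ h₁)) c h₂`. The case of interest is `c = 1`, but a product `h h'`
feeds the value for `h` into the sandwich for `h'`, which forces a general `c`. On a generator, `c`
is moved past `h₂` and becomes a right factor `c'`, still in the subalgebra. -/
theorem opSandwich_leviCoaction_mem (h : Parabolic q n) {c : Parabolic q n}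
    (hc : c ∈ Algebra.adjoin K (Set.range fun s : Fin n => (beta q s : Parabolic q n))) :
    opSandwich (leviAntipode q n) c (leviCoaction q n h) ∈
      Algebra.adjoin K (Set.range fun s : Fin n => (beta q s : Parabolic q n)) := by
  induction h using induction generalizing c with
  | hp i j =>
    obtain ⟨c', hc', h1, -⟩ := exists_twist (.id K _) (.id K _) (fun s => mu q j s * mu q 0 j) hc
    have e : opSandwich (leviAntipode q n) c (leviCoaction q n (p q n i j)) =
        (∑ k, (antipodeHom q n (splitHom q n (p q n i k))).unop * p q n k j) * c' := by
      rw [leviCoaction, AlgHom.comp_apply, Bialgebra.comulAlgHom_apply, comul_eq, comulHom_p,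
        map_sum, map_sum, Finset.sum_mul]
      refine Finset.sum_congr rfl fun k _ => ?_
      rw [Algebra.TensorProduct.map_tmul, opSandwich_tmul, leviAntipode_prLevi, mul_assoc,
        mul_assoc]
      congr 1
      exact h1 _ fun s => beta_mul_p s k j
    rw [e, sum_antipode_splitHom_mul_p]
    split_ifs
    · exact mul_mem (Algebra.subset_adjoin (Set.mem_range_self j)) hc'
    · rwa [one_mul]
    · rw [zero_mul]; exact zero_mem _
  | hd =>
    obtain ⟨c', hc', h1, -⟩ := exists_twist (.id K _) (.id K _)
      (fun s => (∏ j, mu q j s * mu q 0 j)⁻¹) hc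
    have e : opSandwich (leviAntipode q n) c (leviCoaction q n (detInv q n)) = c' := by
      rw [leviCoaction, AlgHom.comp_apply, Bialgebra.comulAlgHom_apply, comul_eq, comulHom_detInv,
        Algebra.TensorProduct.map_tmul, opSandwich_tmul, leviAntipode_prLevi, splitHom_detInv,
        antipodeHom_detInv, MulOpposite.unop_op, mul_assoc]
      have h2 : c * detInv q n = detInv q n * c' := h1 _ fun s => beta_mul_detInv s
      rw [AlgHom.id_apply, h2, ← mul_assoc, qdet_mul_detInv, one_mul]
    rwa [e]
  | halg r =>
    rw [AlgHom.commutes, Algebra.algebraMap_eq_smul_one, map_smul, Algebra.TensorProduct.one_def,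
      opSandwich_tmul]
    simpa using Subalgebra.smul_mem _ hc r
  | hadd x y hx hy => rw [map_add, map_add]; exact add_mem (hx hc) (hy hc)
  | hmul x y hx hy => rw [map_mul, opSandwich_mul]; exact hy (hx hc)

/-- For a coinvariant `k` the coaction is `1 ⊗ k`, so the sandwich with `c = 1` returns `k` itself,
which therefore lies in the subalgebra. -/
theorem leviCoinv_eq_adjoin :
    leviCoinv q n = Algebra.adjoin K (Set.range fun s : Fin n => (beta q s : Parabolic q n)) := by
  refine le_antisymm (fun k hk => ?_) (Algebra.adjoin_le ?_)
  · have h1 : leviCoaction q n k = 1 ⊗ₜ k := hk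
    have h2 := opSandwich_leviCoaction_mem k (one_mem (Algebra.adjoin K
      (Set.range fun s : Fin n => (beta q s : Parabolic q n))))
    rw [h1, opSandwich_tmul] at h2
    simpa using h2
  · rintro _ ⟨s, rfl⟩
    exact (beta q s).2

theorem adjoin_beta : Algebra.adjoin K (Set.range (beta q (n := n))) = ⊤ := by
  apply Subalgebra.map_injective (f := (leviCoinv q n).val) Subtype.val_injective
  rw [AlgHom.map_adjoin, ← Set.range_comp, Algebra.map_top, Subalgebra.range_val]
  exact leviCoinv_eq_adjoin.symm

/-- Algebra maps on the coinvariants are determined by their values on the elements `β s`. -/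
theorem leviCoinv_algHom_ext {R : Type*} [Ring R] [Algebra K R] {f g : leviCoinv q n →ₐ[K] R}
    (h : ∀ s, s ≠ 0 → f (beta q s) = g (beta q s)) : f = g := by
  refine AlgHom.ext_of_adjoin_eq_top adjoin_beta ?_
  rintro _ ⟨s, rfl⟩
  by_cases hs : s = 0
  · rw [hs, beta_zero, map_one, map_one]
  · exact h s hs

end Parabolic

end LeviCoinvariants

/-! ### Existence of the algebra map from the coinvariants to a chart. -/

noncomputable section ChartMaps

variable {K : Type*} [Field K] {n : ℕ} [NeZero n] {q : Kˣ}

theorem coaction_a (S : Set (Fin n)) (i j : Fin n) :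
    coaction q S (GLLoc.a q S i j) = ∑ k, GLLoc.a q S i k ⊗ₜ Parabolic.p q n k j := by
  rw [coaction, GLLoc.lift_a]; rfl

theorem coaction_detInv (S : Set (Fin n)) :
    coaction q S (GLLoc.detInv q S) = GLLoc.detInv q S ⊗ₜ Parabolic.detInv q n := by
  rw [coaction, GLLoc.lift_detInv]

theorem coaction_aInv {S : Set (Fin n)} (ℓ : S) : coaction q S (GLLoc.aInv q S ℓ) =
    GLLoc.aInv q S ℓ ⊗ₜ (↑(Parabolic.pUnit q n)⁻¹ : Parabolic q n) := by
  rw [coaction, GLLoc.lift_aInv]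

theorem coaction_a_zero (S : Set (Fin n)) (i : Fin n) :
    coaction q S (GLLoc.a q S i 0) = GLLoc.a q S i 0 ⊗ₜ Parabolic.p q n 0 0 := by
  rw [coaction_a, Finset.sum_eq_single 0]
  · intro k _ hk; rw [Parabolic.p_zero hk, TensorProduct.tmul_zero]
  · simp

theorem chart_a_mul_aInv (ℓ : Fin n) :
    GLLoc.a q {ℓ} ℓ 0 * GLLoc.aInv q {ℓ} ⟨ℓ, rfl⟩ = 1 :=
  GLLoc.a_mul_aInv (S := {ℓ}) ⟨ℓ, rfl⟩

theorem chart_aInv_mul_a (ℓ : Fin n) :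
    GLLoc.aInv q {ℓ} ⟨ℓ, rfl⟩ * GLLoc.a q {ℓ} ℓ 0 = 1 :=
  GLLoc.aInv_mul_a (S := {ℓ}) ⟨ℓ, rfl⟩

theorem nu_zero (ℓ : Fin n) : nu q ℓ 0 = 1 := chart_aInv_mul_a ℓ

/-- The scalars coincide with those of `beta_mul_p`; every compatibility of `f` with products in the
chart comes from this. -/
theorem nu_mul_a (ℓ s k j : Fin n) : nu q ℓ s * GLLoc.a q {ℓ} k j =
    (mu q j s * mu q 0 j) • (GLLoc.a q {ℓ} k j * nu q ℓ s) :=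
  GLLoc.isQMatrix.ratio_mul (chart_a_mul_aInv ℓ) (chart_aInv_mul_a ℓ) s k j

theorem nu_mul_detInv (ℓ s : Fin n) : nu q ℓ s * GLLoc.detInv q {ℓ} =
    (∏ j, mu q j s * mu q 0 j)⁻¹ • (GLLoc.detInv q {ℓ} * nu q ℓ s) :=
  mul_inv_smul GLLoc.qdet_mul_detInv GLLoc.detInv_mul_qdet
    (mul_qdet_of_col fun k j => nu_mul_a ℓ s k j)

/-- The character `p i j ↦ δ i j t j` of `H`. -/
def diagChar (q : Kˣ) (t : Fin n → Kˣ) : Parabolic q n →ₐ[K] K :=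
  have hdet : qdet q (Matrix.diagonal fun i => (t i : K)) = (∏ i, t i : Kˣ) := by
    rw [qdet_of_zero_off_row fun i j _ h => Matrix.diagonal_apply_ne _ h]
    simp [List.prod_ofFn]
  Parabolic.lift (M := Matrix.diagonal fun i => (t i : K)) (d := (∏ i, t i : Kˣ)⁻¹)
    (isQMatrix_diagonal _)
    (by rw [hdet, mul_inv_cancel₀ (Units.ne_zero _)])
    (by rw [hdet, inv_mul_cancel₀ (Units.ne_zero _)])
    (fun s hs => Matrix.diagonal_apply_ne _ hs)

theorem diagChar_p (t : Fin n → Kˣ) (i j : Fin n) :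
    diagChar q t (Parabolic.p q n i j) = Matrix.diagonal (fun i => (t i : K)) i j := by
  rw [diagChar, Parabolic.lift_p]

/-- The endomorphism `a i j ↦ t j • a i j` of `A[a ℓ 1 ⁻¹, ℓ ∈ S]`. -/
def colScale (q : Kˣ) (S : Set (Fin n)) (t : Fin n → Kˣ) : GLLoc q S →ₐ[K] GLLoc q S :=
  ((Algebra.TensorProduct.rid K K (GLLoc q S)).toAlgHom.comp
    (Algebra.TensorProduct.map (.id K _) (diagChar q t))).comp (coaction q S)

theorem colScale_a (S : Set (Fin n)) (t : Fin n → Kˣ) (i j : Fin n) :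
    colScale q S t (GLLoc.a q S i j) = t j • GLLoc.a q S i j := by
  simp only [colScale, AlgHom.comp_apply, coaction_a, map_sum, Algebra.TensorProduct.map_tmul,
    diagChar_p]
  rw [Finset.sum_eq_single j]
  · simp [Units.smul_def]
  · intro k _ hk; rw [Matrix.diagonal_apply_ne _ hk, TensorProduct.tmul_zero, map_zero]
  · simp

theorem colScale_mul (S : Set (Fin n)) (t t' : Fin n → Kˣ) :
    (colScale q S t).toLinearMap * (colScale q S t').toLinearMap =
      (colScale q S (t * t')).toLinearMap := by
  have h : (colScale q S t).comp (colScale q S t') = colScale q S (t * t') := by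
    refine GLLoc.algHom_ext fun i j => ?_
    simp [colScale_a, Units.smul_def, smul_smul, mul_comm]
  rw [← h]
  rfl

theorem colScale_one (S : Set (Fin n)) : (colScale q S 1).toLinearMap = 1 := by
  have h : colScale q S 1 = .id K _ := by
    refine GLLoc.algHom_ext fun i j => ?_
    simp [colScale_a]
  rw [h]
  rfl

/-- Operators on the chart `A_ℓ`: left multiplications by the `a ℓ s` in the first row, and
rescalings of the columns on the diagonal. -/
def chartOperators (q : Kˣ) (ℓ : Fin n) : Matrix (Fin n) (Fin n) (Module.End K (Chart q ℓ)) :=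
  Matrix.of fun i j => if i = 0 then LinearMap.mulLeft K (GLLoc.a q {ℓ} ℓ j) else
    if i = j then (colScale q {ℓ} fun k => mu q i 0 * mu q k i).toLinearMap else 0

theorem chartOperators_zero (ℓ j : Fin n) :
    chartOperators q ℓ 0 j = LinearMap.mulLeft K (GLLoc.a q {ℓ} ℓ j) := by
  rw [chartOperators, Matrix.of_apply, if_pos rfl]

theorem chartOperators_diag (ℓ : Fin n) {i : Fin n} (hi : i ≠ 0) : chartOperators q ℓ i i =
    (colScale q {ℓ} fun k => mu q i 0 * mu q k i).toLinearMap := by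
  rw [chartOperators, Matrix.of_apply, if_neg hi, if_pos rfl]

theorem chartOperators_off (ℓ : Fin n) {i j : Fin n} (hi : i ≠ 0) (hij : i ≠ j) :
    chartOperators q ℓ i j = 0 := by
  rw [chartOperators, Matrix.of_apply, if_neg hi, if_neg hij]

/-- The rescaling factors in `chartOperators` are chosen for this: they are the scalars that the
relation between the entries `(j, j)` and `(1, k)` of a `q`-matrix demands. -/
theorem chartOperators_diag_mul (ℓ k : Fin n) {j : Fin n} (hj : j ≠ 0) :
    chartOperators q ℓ j j * chartOperators q ℓ 0 k =
      (mu q j 0 * mu q k j) • (chartOperators q ℓ 0 k * chartOperators q ℓ j j) := by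
  ext x
  simp [chartOperators_zero, chartOperators_diag ℓ hj, colScale_a, smul_mul_assoc]

theorem isQMatrix_chartOperators (ℓ : Fin n) : IsQMatrix q (chartOperators q ℓ) := by
  intro i j k l
  by_cases hi : i = 0
  · by_cases hj : j = 0
    · subst hi hj
      ext x
      have := GLLoc.isQMatrix (q := q) (S := {ℓ}) ℓ ℓ k l
      rw [mu_self] at this
      simp [chartOperators_zero, ← mul_assoc, this, smul_mul_assoc]
    · by_cases hjl : j = l
      · subst hi hjl
        rw [chartOperators_diag_mul ℓ k hj, smul_smul]
        have h : mu q 0 j * mu q j k * (mu q j 0 * mu q k j) = 1 := by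
          rw [mul_mul_mul_comm, mu_mul_mu, mu_mul_mu, one_mul]
        rw [h, one_smul]
      · simp [chartOperators_off ℓ hj hjl]
  · by_cases hik : i = k
    · subst hik
      by_cases hj : j = 0
      · subst hj
        exact chartOperators_diag_mul ℓ l hi
      · by_cases hjl : j = l
        · subst hjl
          rw [mu_mul_mu, one_smul, chartOperators_diag ℓ hi, chartOperators_diag ℓ hj,
            colScale_mul, colScale_mul, mul_comm]
        · simp [chartOperators_off ℓ hj hjl]
    · simp [chartOperators_off ℓ hi hik]

theorem isUnit_chartOperators (ℓ i : Fin n) : IsUnit (chartOperators q ℓ i i) := by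
  by_cases hi : i = 0
  · subst hi
    rw [chartOperators_zero]
    refine isUnit_iff_exists.mpr ⟨LinearMap.mulLeft K (GLLoc.aInv q {ℓ} ⟨ℓ, rfl⟩), ?_, ?_⟩
    · rw [Module.End.mul_eq_comp, ← LinearMap.mulLeft_mul, chart_a_mul_aInv, LinearMap.mulLeft_one]
      rfl
    · rw [Module.End.mul_eq_comp, ← LinearMap.mulLeft_mul, chart_aInv_mul_a, LinearMap.mulLeft_one]
      rfl
  · rw [chartOperators_diag ℓ hi]
    refine isUnit_iff_exists.mpr ⟨(colScale q {ℓ} (fun k => mu q i 0 * mu q k i)⁻¹).toLinearMap,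
      ?_, ?_⟩
    · rw [colScale_mul, mul_inv_cancel, colScale_one]
    · rw [colScale_mul, inv_mul_cancel, colScale_one]

/-- The determinant reduces to a product of invertible diagonal operators: left multiplication by `a
ℓ 1`, and rescalings. Its inverse is the image of `D⁻¹` in the representation. -/
theorem isUnit_qdet_chartOperators (ℓ : Fin n) : IsUnit (qdet q (chartOperators q ℓ)) := by
  rw [qdet_of_zero_off_row fun i j => chartOperators_off ℓ]
  refine List.prod_induction IsUnit (fun _ _ => IsUnit.mul) isUnit_one ?_
  intro x hx
  obtain ⟨i, rfl⟩ := (List.mem_ofFn' _ _).mp hx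
  exact isUnit_chartOperators ℓ i

/-- A representation of `H` on the chart `A_ℓ` in which `p 1 s` acts as left multiplication by
`a ℓ s`. -/
def chartRep (q : Kˣ) (ℓ : Fin n) : Parabolic q n →ₐ[K] Module.End K (Chart q ℓ) :=
  Parabolic.lift (isQMatrix_chartOperators ℓ)
    (d := ↑(isUnit_qdet_chartOperators (q := q) ℓ).unit⁻¹)
    (isUnit_qdet_chartOperators ℓ).mul_val_inv (isUnit_qdet_chartOperators ℓ).val_inv_mul
    (fun _ hs => chartOperators_off ℓ hs hs)

/-- The equation `p 1 1 * β s = p 1 s` determines the action of `β s`, since `p 1 1` acts by an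
invertible operator. -/
theorem chartRep_beta (ℓ s : Fin n) :
    chartRep q ℓ (Parabolic.beta q s) = LinearMap.mulLeft K (nu q ℓ s) := by
  have h (s) : chartRep q ℓ (Parabolic.p q n 0 s) = LinearMap.mulLeft K (GLLoc.a q {ℓ} ℓ s) :=
    (Parabolic.lift_p _ _ _ _ _ _).trans (chartOperators_zero ℓ s)
  have hu : IsUnit (LinearMap.mulLeft K (GLLoc.a q {ℓ} ℓ 0)) := by
    rw [← chartOperators_zero]; exact isUnit_chartOperators ℓ 0
  refine hu.mul_left_cancel ?_
  rw [Module.End.mul_eq_comp _ (LinearMap.mulLeft K (nu q ℓ s)), ← LinearMap.mulLeft_mul, nu,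
    ← mul_assoc, chart_a_mul_aInv, one_mul, ← h, ← h, ← map_mul, Parabolic.coe_beta, ← mul_assoc,
    Parabolic.p_mul_pUnit_inv, one_mul]

/-- Left multiplications form a subalgebra of the operators, and the generators `β s` act by such.
This makes `k ↦ k · 1` multiplicative. -/
theorem chartRep_eq_mulLeft (ℓ : Fin n) (k : Parabolic.leviCoinv q n) :
    chartRep q ℓ k = LinearMap.mulLeft K (chartRep q ℓ k 1) := by
  have hk : k ∈ Algebra.adjoin K (Set.range (Parabolic.beta q)) := by
    rw [Parabolic.adjoin_beta]; trivial
  induction hk using Algebra.adjoin_induction with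
  | mem x hx =>
    obtain ⟨s, rfl⟩ := hx
    rw [chartRep_beta, LinearMap.mulLeft_apply, mul_one]
  | algebraMap c =>
    rw [Subalgebra.coe_algebraMap, AlgHom.commutes]
    ext x
    simp
  | add x y _ _ hx hy =>
    ext z
    rw [Subalgebra.coe_add, map_add, LinearMap.add_apply, hx, hy]
    simp [add_mul]
  | mul x y _ _ hx hy =>
    ext z
    rw [Subalgebra.coe_mul, map_mul, hx, hy]
    simp

/-- The algebra map from the coinvariants to the chart `A_ℓ` with `β s ↦ a ℓ 1 ⁻¹ * a ℓ s`. -/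
def chartMap (q : Kˣ) (ℓ : Fin n) : Parabolic.leviCoinv q n →ₐ[K] Chart q ℓ :=
  AlgHom.ofLinearMap
    (LinearMap.applyₗ 1 ∘ₗ (chartRep q ℓ).toLinearMap ∘ₗ (Parabolic.leviCoinv q n).val.toLinearMap)
    (by simp)
    (fun x y => by
      change chartRep q ℓ (x * y : Parabolic q n) 1 = _
      rw [map_mul, Module.End.mul_apply, chartRep_eq_mulLeft]
      rfl)

theorem chartMap_beta (ℓ s : Fin n) : chartMap q ℓ (Parabolic.beta q s) = nu q ℓ s := by
  change chartRep q ℓ (Parabolic.beta q s) 1 = _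
  rw [chartRep_beta, LinearMap.mulLeft_apply, mul_one]

end ChartMaps

/-! ### The bimodule `A ⊗_B A` and the bilinearity of the canonical map. -/

noncomputable section BalancedTensor

variable {K : Type*} [Field K] {A : Type*} [Ring A] [Algebra K A]

/-- The class of `x ⊗ y` in `A ⊗_B A`. -/
def balTmul (B : Subalgebra K A) (x y : A) : BalancedTensor B := (balancedRel B).mkQ (x ⊗ₜ y)

variable {B : Subalgebra K A}

theorem balTmul_mul (x y : A) (b : B) : balTmul B (x * b) y = balTmul B x (b * y) := by
  refine (Submodule.Quotient.eq _).mpr (Submodule.subset_span ⟨x, y, b, rfl⟩)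

theorem BalancedTensor.induction {P : BalancedTensor B → Prop} (h0 : P 0)
    (htmul : ∀ x y, P (balTmul B x y)) (hadd : ∀ v w, P v → P w → P (v + w))
    (v : BalancedTensor B) : P v := by
  obtain ⟨z, rfl⟩ := Submodule.mkQ_surjective _ v
  induction z with
  | zero => rwa [map_zero]
  | tmul x y => exact htmul x y
  | add x y hx hy => rw [map_add]; exact hadd _ _ hx hy

theorem BalancedTensor.hom_ext {V : Type*} [AddCommGroup V] [Module K V]
    {f g : BalancedTensor B →ₗ[K] V} (h : ∀ x y, f (balTmul B x y) = g (balTmul B x y)) : f = g :=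
  Submodule.linearMap_qext _ (TensorProduct.ext' h)

/-- The left multiplication of `A` on `A ⊗_B A`. -/
def balLeft (B : Subalgebra K A) : A →ₐ[K] Module.End K (BalancedTensor B) :=
  have key (x : A) : balancedRel B ≤
      (balancedRel B).comap (TensorProduct.map (LinearMap.mulLeft K x) .id) := by
    rw [balancedRel, Submodule.span_le]
    rintro _ ⟨y, z, b, rfl⟩
    refine Submodule.subset_span ⟨x * y, z, b, ?_⟩
    simp [mul_assoc]
  AlgHom.ofLinearMap
    { toFun := fun x => (balancedRel B).mapQ (balancedRel B) _ (key x)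
      map_add' := fun x y => BalancedTensor.hom_ext fun a b => by
        simp [balTmul, add_mul, TensorProduct.add_tmul]
      map_smul' := fun c x => BalancedTensor.hom_ext fun a b => by
        simp [balTmul, ← TensorProduct.smul_tmul'] }
    (BalancedTensor.hom_ext fun a b => by simp [balTmul])
    (fun x y => BalancedTensor.hom_ext fun a b => by simp [balTmul])

theorem balLeft_balTmul (x y z : A) : balLeft B x (balTmul B y z) = balTmul B (x * y) z := rfl

/-- The right multiplication of `A` on `A ⊗_B A`. -/
def balRight (B : Subalgebra K A) : A →ₐ[K] (Module.End K (BalancedTensor B))ᵐᵒᵖ :=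
  have key (x : A) : balancedRel B ≤
      (balancedRel B).comap (TensorProduct.map .id (LinearMap.mulRight K x)) := by
    rw [balancedRel, Submodule.span_le]
    rintro _ ⟨y, z, b, rfl⟩
    refine Submodule.subset_span ⟨y, z * x, b, ?_⟩
    simp [mul_assoc]
  AlgHom.ofLinearMap
    { toFun := fun x => MulOpposite.op ((balancedRel B).mapQ (balancedRel B) _ (key x))
      map_add' := fun x y => MulOpposite.unop_injective <| BalancedTensor.hom_ext fun a b => by
        simp [balTmul, mul_add, TensorProduct.tmul_add]
      map_smul' := fun c x => MulOpposite.unop_injective <| BalancedTensor.hom_ext fun a b => by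
        simp [balTmul] }
    (MulOpposite.unop_injective <| BalancedTensor.hom_ext fun a b => by simp [balTmul])
    (fun x y => MulOpposite.unop_injective <| BalancedTensor.hom_ext fun a b => by
      simp [balTmul, mul_assoc])

theorem balRight_balTmul (x y z : A) :
    (balRight B x).unop (balTmul B y z) = balTmul B y (z * x) := rfl

theorem balLeft_balRight (x y : A) (v : BalancedTensor B) :
    balLeft B x ((balRight B y).unop v) = (balRight B y).unop (balLeft B x v) := by
  induction v using BalancedTensor.induction with
  | h0 => simp
  | htmul a b => rfl
  | hadd v w hv hw => simp only [map_add, hv, hw]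

theorem balLeft_mul (x y : A) (v : BalancedTensor B) :
    balLeft B (x * y) v = balLeft B x (balLeft B y v) := by
  rw [map_mul]; rfl

theorem balRight_mul (x y : A) (v : BalancedTensor B) :
    (balRight B (x * y)).unop v = (balRight B y).unop ((balRight B x).unop v) := by
  rw [map_mul]; rfl

variable {H : Type*} [Ring H] [HopfAlgebra K H] (δ : A →ₐ[K] A ⊗[K] H)

theorem canonicalMap_balTmul (x y : A) :
    canonicalMap δ (balTmul _ x y) = (x ⊗ₜ 1) * δ y := rfl

/-- Together with `canonicalMap_balRight`, this makes `χ` a bimodule map, with `A` acting on `A ⊗ H`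
through `x ⊗ 1` from the left and through `δ x` from the right. -/
theorem canonicalMap_balLeft (x : A) (v : BalancedTensor (coinvariants δ)) :
    canonicalMap δ (balLeft _ x v) = (x ⊗ₜ 1) * canonicalMap δ v := by
  induction v using BalancedTensor.induction with
  | h0 => simp
  | htmul a b =>
    rw [balLeft_balTmul, canonicalMap_balTmul, canonicalMap_balTmul, ← mul_assoc,
      Algebra.TensorProduct.tmul_mul_tmul, one_mul]
  | hadd v w hv hw => simp only [map_add, mul_add, hv, hw]

theorem canonicalMap_balRight (x : A) (v : BalancedTensor (coinvariants δ)) :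
    canonicalMap δ ((balRight _ x).unop v) = canonicalMap δ v * δ x := by
  induction v using BalancedTensor.induction with
  | h0 => simp
  | htmul a b =>
    rw [balRight_balTmul, canonicalMap_balTmul, canonicalMap_balTmul, map_mul, mul_assoc]
  | hadd v w hv hw => simp only [map_add, add_mul, hv, hw]

end BalancedTensor

/-! ### The charts are Hopf-Galois extensions. -/

noncomputable section Galois

variable {K : Type*} [Field K] {n : ℕ} [NeZero n] {q : Kˣ}

/-- The inverse of the matrix of the `a i j`. -/
def GLLoc.matInv (q : Kˣ) (S : Set (Fin n)) : Matrix (Fin n) (Fin n) (GLLoc q S) :=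
  ((GLLoc.isQMatrix.isUnit GLLoc.qdet_mul_detInv GLLoc.detInv_mul_qdet).unit⁻¹ :
    (Matrix (Fin n) (Fin n) (GLLoc q S))ˣ)

theorem GLLoc.a_mul_matInv (S : Set (Fin n)) : GLLoc.a q S * GLLoc.matInv q S = 1 :=
  (GLLoc.isQMatrix.isUnit GLLoc.qdet_mul_detInv GLLoc.detInv_mul_qdet).mul_val_inv

theorem GLLoc.matInv_mul_a (S : Set (Fin n)) : GLLoc.matInv q S * GLLoc.a q S = 1 :=
  (GLLoc.isQMatrix.isUnit GLLoc.qdet_mul_detInv GLLoc.detInv_mul_qdet).val_inv_mul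

/-- In the opposite algebra, the inverse matrix plays the role of the antipode applied to `a`.
Knowing its determinant shows how `D` and `D⁻¹` have to act in `chartAct`. -/
theorem GLLoc.qdet_op_matInv (S : Set (Fin n)) :
    qdet q ((GLLoc.matInv q S).map MulOpposite.op) = MulOpposite.op (GLLoc.detInv q S) := by
  apply MulOpposite.unop_injective
  have h := qdet_op_inv_mul (q := q) GLLoc.isQMatrix (GLLoc.matInv_mul_a (q := q) S)
  exact left_inv_eq_right_inv h GLLoc.qdet_mul_detInv

/-- The coordinate `a m 1 * a ℓ 1 ⁻¹` on the base `B_ℓ` of the chart `A_ℓ`. -/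
def baseCoord (q : Kˣ) (ℓ m : Fin n) : Chart q ℓ :=
  GLLoc.a q {ℓ} m 0 * GLLoc.aInv q {ℓ} ⟨ℓ, rfl⟩

theorem baseCoord_mul_a (ℓ m : Fin n) :
    baseCoord q ℓ m * GLLoc.a q {ℓ} ℓ 0 = GLLoc.a q {ℓ} m 0 := by
  rw [baseCoord, mul_assoc, chart_aInv_mul_a, mul_one]

/-- Here the scalar depends on the row `i` and not on the column `k`, the reverse of `nu_mul_a`. -/
theorem a_mul_baseCoord (ℓ m i k : Fin n) : GLLoc.a q {ℓ} i k * baseCoord q ℓ m =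
    (mu q i m * mu q ℓ i) • (baseCoord q ℓ m * GLLoc.a q {ℓ} i k) :=
  GLLoc.isQMatrix.mul_colRatio (chart_a_mul_aInv ℓ) (chart_aInv_mul_a ℓ) i m k

/-- Modulo `p s 1 = 0` for `s ≠ 1`, the coaction multiplies the whole first column by `p 1 1`, which
cancels in the quotient. These are the only explicit coinvariants that the Galois property needs; no
description of `B_ℓ` is required. -/
theorem baseCoord_mem (ℓ m : Fin n) : baseCoord q ℓ m ∈ coinvariants (coaction q {ℓ}) := by
  change coaction q {ℓ} (baseCoord q ℓ m) = baseCoord q ℓ m ⊗ₜ 1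
  rw [baseCoord, map_mul, coaction_a_zero, coaction_aInv, Algebra.TensorProduct.tmul_mul_tmul,
    Parabolic.p_mul_pUnit_inv]

variable (q) in
/-- The tensor product `A_ℓ ⊗_{B_ℓ} A_ℓ`. -/
abbrev ChartTensor (ℓ : Fin n) : Type _ := BalancedTensor (coinvariants (coaction q {ℓ}))

/-- The left multiplication of `A_ℓ` on `A_ℓ ⊗_{B_ℓ} A_ℓ`. -/
abbrev chartLeft {ℓ : Fin n} (x : Chart q ℓ) : Module.End K (ChartTensor q ℓ) := balLeft _ x

/-- The right multiplication of `A_ℓ` on `A_ℓ ⊗_{B_ℓ} A_ℓ`. -/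
abbrev chartRight {ℓ : Fin n} (x : Chart q ℓ) : Module.End K (ChartTensor q ℓ) :=
  (balRight _ x).unop

/-- The elements of `A_ℓ ⊗_{B_ℓ} A_ℓ` that commute with the coordinates of the base. -/
def chartCentral (q : Kˣ) (ℓ : Fin n) : Submodule K (ChartTensor q ℓ) :=
  ⨅ m, LinearMap.eqLocus (chartLeft (baseCoord q ℓ m)) (chartRight (baseCoord q ℓ m))

theorem mem_chartCentral {ℓ : Fin n} {v : ChartTensor q ℓ} : v ∈ chartCentral q ℓ ↔
    ∀ m, chartLeft (baseCoord q ℓ m) v = chartRight (baseCoord q ℓ m) v := by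
  simp [chartCentral]

/-- The right action of the quantum general linear group on `A_ℓ ⊗_{B_ℓ} A_ℓ` for which `x` acts as
`v ↦ S(x₁) v x₂`. -/
def chartAct (q : Kˣ) (ℓ : Fin n) : QGL q n →ₐ[K] (Module.End K (ChartTensor q ℓ))ᵐᵒᵖ :=
  let L := AlgHom.op (balLeft (coinvariants (coaction q {ℓ})))
  let R := balRight (coinvariants (coaction q {ℓ}))
  -- Left and right multiplications commute. Hence the product of the two `q`-matrices is again a
  -- `q`-matrix, with multiplicative determinant.
  have hc (x y) : Commute (L x) (R y) :=
    MulOpposite.unop_injective <| LinearMap.ext fun v => (balLeft_balRight x.unop y v).symm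
  have hdet : qdet q ((((GLLoc.matInv q {ℓ}).map MulOpposite.op).map L) *
      ((GLLoc.a q {ℓ}).map R)) = L (MulOpposite.op (GLLoc.detInv q {ℓ})) *
        R (qdet q (GLLoc.a q {ℓ})) :=
    (qdet_mul (X := ((GLLoc.matInv q {ℓ}).map MulOpposite.op).map L) (GLLoc.isQMatrix.map R)
      fun _ _ _ _ => hc _ _).trans <| by
      rw [qdet_map, qdet_map, GLLoc.qdet_op_matInv]
  have hd (x x' y y') : L x * R y * (L x' * R y') = L (x * x') * R (y * y') := by
    rw [map_mul, map_mul, (hc _ _).mul_mul_mul_comm]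
  GLLoc.lift (S := ∅)
    (((GLLoc.isQMatrix.op_inv (GLLoc.a_mul_matInv {ℓ}) (GLLoc.matInv_mul_a {ℓ})).map L).mul
      (GLLoc.isQMatrix.map R) fun _ _ _ _ => hc _ _)
    (d := L (MulOpposite.op (qdet q (GLLoc.a q {ℓ}))) * R (GLLoc.detInv q {ℓ}))
    (x := fun ℓ => ℓ.2.elim)
    (by rw [hdet, hd, ← MulOpposite.op_mul, GLLoc.qdet_mul_detInv]; simp)
    (by rw [hdet, hd, ← MulOpposite.op_mul, GLLoc.detInv_mul_qdet]; simp)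
    (fun ℓ => ℓ.2.elim) (fun ℓ => ℓ.2.elim)

theorem chartAct_a (ℓ i j : Fin n) (v : ChartTensor q ℓ) :
    (chartAct q ℓ (GLLoc.a q ∅ i j)).unop v =
      ∑ k, chartLeft (GLLoc.matInv q {ℓ} i k) (chartRight (GLLoc.a q {ℓ} k j) v) := by
  rw [chartAct, GLLoc.lift_a, Matrix.mul_apply, Finset.unop_sum, LinearMap.sum_apply]
  refine Finset.sum_congr rfl fun k _ => ?_
  exact (balLeft_balRight _ _ v).symm

theorem chartAct_detInv (ℓ : Fin n) (v : ChartTensor q ℓ) :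
    (chartAct q ℓ (GLLoc.detInv q ∅)).unop v =
      chartLeft (qdet q (GLLoc.a q {ℓ})) (chartRight (GLLoc.detInv q {ℓ}) v) := by
  rw [chartAct, GLLoc.lift_detInv]
  exact (balLeft_balRight _ _ v).symm

/-- Moving the base coordinate inwards past `x` from the left, or past `y` from the right, costs the
same scalar, and in the middle it passes through `v`. -/
theorem chartCentral_smul {ℓ m : Fin n} {x y : Chart q ℓ} {c : Kˣ}
    (hx : baseCoord q ℓ m * x = c • (x * baseCoord q ℓ m))
    (hy : y * baseCoord q ℓ m = c • (baseCoord q ℓ m * y)) {v : ChartTensor q ℓ}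
    (hv : v ∈ chartCentral q ℓ) :
    chartLeft (baseCoord q ℓ m) (chartLeft x (chartRight y v)) =
      chartRight (baseCoord q ℓ m) (chartLeft x (chartRight y v)) := by
  rw [← balLeft_balRight, ← balRight_mul, hy, ← Module.End.mul_apply, ← map_mul, hx]
  simp only [Units.smul_def, map_smul, MulOpposite.unop_smul, LinearMap.smul_apply]
  rw [map_mul, Module.End.mul_apply, balLeft_balRight, mem_chartCentral.mp hv m, ← balRight_mul]

/-- In each summand `Y i k v a k j`, the scalar of `a k j` depends only on the row `k`, while that
of the inverse entry depends only on its column, again `k`. The two match term by term. -/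
theorem chartAct_mem (ℓ : Fin n) (x : QGL q n) {v : ChartTensor q ℓ} (hv : v ∈ chartCentral q ℓ) :
    (chartAct q ℓ x).unop v ∈ chartCentral q ℓ := by
  induction x using GLLoc.induction generalizing v with
  | ha i j =>
    rw [chartAct_a]
    refine sum_mem fun k _ => mem_chartCentral.mpr fun m => ?_
    refine chartCentral_smul (c := mu q k m * mu q ℓ k) ?_ (a_mul_baseCoord ℓ m k j) hv
    have h := inv_comm_of_comm (GLLoc.a_mul_matInv {ℓ}) (GLLoc.matInv_mul_a {ℓ})
      (x := baseCoord q ℓ m) (e := fun i => mu q i m * mu q ℓ i) (f := fun _ => 1)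
      (fun i j => by rw [mul_one, a_mul_baseCoord]) i k
    rw [h, smul_smul, inv_one, one_mul, mul_inv_cancel, one_smul]
  | hd =>
    rw [chartAct_detInv]
    refine mem_chartCentral.mpr fun m => ?_
    have h1 : baseCoord q ℓ m * qdet q (GLLoc.a q {ℓ}) = (∏ i, (mu q i m * mu q ℓ i)⁻¹) •
        (qdet q (GLLoc.a q {ℓ}) * baseCoord q ℓ m) :=
      mul_qdet_of_row fun i j => by rw [a_mul_baseCoord, inv_smul_smul]
    refine chartCentral_smul h1 ?_ hv
    rw [mul_inv_smul GLLoc.qdet_mul_detInv GLLoc.detInv_mul_qdet h1, smul_smul, mul_inv_cancel,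
      one_smul]
  | hi ℓ => exact ℓ.2.elim
  | halg c =>
    rw [AlgHom.commutes]
    exact Submodule.smul_mem _ c hv
  | hadd x y hx hy =>
    rw [map_add]
    exact add_mem (hx hv) (hy hv)
  | hmul x y hx hy =>
    rw [map_mul]
    exact hy (hx hv)

/-- The restriction of the action `chartAct` to the elements that commute with the base. -/
def chartCentralAct (q : Kˣ) (ℓ : Fin n) : QGL q n →ₐ[K] (Module.End K (chartCentral q ℓ))ᵐᵒᵖ :=
  AlgHom.ofLinearMap
    { toFun := fun x => MulOpposite.op
        ((chartAct q ℓ x).unop.restrict fun _ hv => chartAct_mem ℓ x hv)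
      map_add' := fun x y => MulOpposite.unop_injective <| by ext v; simp
      map_smul' := fun c x => MulOpposite.unop_injective <| by ext v; simp }
    (MulOpposite.unop_injective <| by ext v; simp)
    (fun x y => MulOpposite.unop_injective <| by ext v; simp)

theorem coe_chartCentralAct (ℓ : Fin n) (x : QGL q n) (v : chartCentral q ℓ) :
    (((chartCentralAct q ℓ x).unop v : chartCentral q ℓ) : ChartTensor q ℓ) =
      (chartAct q ℓ x).unop v := rfl

/-- Writing `a k 1 = (a k 1 * a ℓ 1 ⁻¹) * a ℓ 1` and moving the base coordinate through `v`, the sum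
`∑ k, Y s k v a k 1` becomes `(∑ k, Y s k * a k 1) a ℓ 1 ⁻¹ v a ℓ 1`. The bracket is an off-diagonal
entry of the identity matrix. -/
theorem chartCentralAct_a_zero (ℓ : Fin n) {s : Fin n} (hs : s ≠ 0) :
    chartCentralAct q ℓ (GLLoc.a q ∅ s 0) = 0 := by
  refine MulOpposite.unop_injective (LinearMap.ext fun v => Subtype.ext ?_)
  rw [coe_chartCentralAct, chartAct_a]
  have h (k : Fin n) : chartLeft (GLLoc.matInv q {ℓ} s k) (chartRight (GLLoc.a q {ℓ} k 0) v.1) =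
      chartRight (GLLoc.a q {ℓ} ℓ 0) (chartLeft (GLLoc.matInv q {ℓ} s k * GLLoc.a q {ℓ} k 0)
        (chartLeft (GLLoc.aInv q {ℓ} ⟨ℓ, rfl⟩) v.1)) := by
    have e : chartRight (GLLoc.a q {ℓ} k 0) v.1 =
        chartRight (GLLoc.a q {ℓ} ℓ 0) (chartLeft (baseCoord q ℓ k) v.1) := by
      rw [mem_chartCentral.mp v.2 k, ← balRight_mul, baseCoord_mul_a]
    rw [e, balLeft_balRight, ← balLeft_mul, ← balLeft_mul, baseCoord, mul_assoc]
  simp only [h]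
  rw [← map_sum, ← LinearMap.sum_apply, ← map_sum, ← Matrix.mul_apply, GLLoc.matInv_mul_a,
    Matrix.one_apply_ne hs]
  simp

/-- The action of `H` induced by `chartCentralAct`. -/
def parabolicAct (q : Kˣ) (ℓ : Fin n) :
    Parabolic q n →ₐ[K] (Module.End K (chartCentral q ℓ))ᵐᵒᵖ :=
  Parabolic.descend (q := q) (R := (Module.End K (chartCentral q ℓ))ᵐᵒᵖ) (chartCentralAct q ℓ)
    fun _ hs => chartCentralAct_a_zero (q := q) ℓ hs

theorem parabolicAct_p (ℓ i j : Fin n) (v : chartCentral q ℓ) :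
    ((parabolicAct q ℓ (Parabolic.p q n i j)).unop v : ChartTensor q ℓ) =
      ∑ k, chartLeft (GLLoc.matInv q {ℓ} i k) (chartRight (GLLoc.a q {ℓ} k j) v.1) := by
  rw [parabolicAct, Parabolic.p, Matrix.map_apply, Parabolic.descend_pr, coe_chartCentralAct,
    chartAct_a]

theorem parabolicAct_detInv (ℓ : Fin n) (v : chartCentral q ℓ) :
    ((parabolicAct q ℓ (Parabolic.detInv q n)).unop v : ChartTensor q ℓ) =
      chartLeft (qdet q (GLLoc.a q {ℓ})) (chartRight (GLLoc.detInv q {ℓ}) v.1) := by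
  rw [parabolicAct, Parabolic.detInv, Parabolic.descend_pr, coe_chartCentralAct, chartAct_detInv]

/-- The class of `1 ⊗ 1` in `A_ℓ ⊗_{B_ℓ} A_ℓ`. -/
def chartOne (q : Kˣ) (ℓ : Fin n) : chartCentral q ℓ :=
  ⟨balTmul _ 1 1, mem_chartCentral.mpr fun m => by
    have h := balTmul_mul (1 : Chart q ℓ) 1 ⟨_, baseCoord_mem ℓ m⟩
    rw [balLeft_balTmul, balRight_balTmul, mul_one, one_mul]
    rwa [mul_one, one_mul] at h⟩

/-- The inverse `x ⊗ h ↦ x h⁽¹⁾ ⊗ h⁽²⁾` of the canonical map. -/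
def canonicalInv (q : Kˣ) (ℓ : Fin n) : Chart q ℓ ⊗[K] Parabolic q n →ₗ[K] ChartTensor q ℓ :=
  TensorProduct.lift <| LinearMap.compl₂ (balLeft (coinvariants (coaction q {ℓ}))).toLinearMap
    ((chartCentral q ℓ).subtype ∘ₗ LinearMap.applyₗ (chartOne q ℓ) ∘ₗ
      (MulOpposite.opLinearEquiv K).symm.toLinearMap ∘ₗ (parabolicAct q ℓ).toLinearMap)

theorem canonicalInv_tmul (ℓ : Fin n) (x : Chart q ℓ) (h : Parabolic q n) :
    canonicalInv q ℓ (x ⊗ₜ h) = chartLeft x ((parabolicAct q ℓ h).unop (chartOne q ℓ)).1 := rfl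

/-- For a generator `p i j`, `χ` turns `∑ k, Y i k v a k j` into `∑ r, (∑ k, Y i k * a k r) ⊗ h₀ * p
r j`, where only `r = i` survives. A general `h₀` is needed because products act successively. -/
theorem canonicalMap_parabolicAct (ℓ : Fin n) (h : Parabolic q n) {v : chartCentral q ℓ}
    {h₀ : Parabolic q n} (hv : canonicalMap (coaction q {ℓ}) v.1 = 1 ⊗ₜ h₀) :
    canonicalMap (coaction q {ℓ}) ((parabolicAct q ℓ h).unop v).1 = 1 ⊗ₜ (h₀ * h) := by
  induction h using Parabolic.induction generalizing v h₀ with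
  | hp i j =>
    rw [parabolicAct_p, map_sum]
    simp only [canonicalMap_balLeft, canonicalMap_balRight, hv, coaction_a, Finset.mul_sum,
      Algebra.TensorProduct.tmul_mul_tmul, one_mul]
    rw [Finset.sum_comm]
    simp only [← TensorProduct.sum_tmul, ← Matrix.mul_apply, GLLoc.matInv_mul_a]
    rw [Finset.sum_eq_single i]
    · rw [Matrix.one_apply_eq]
    · intro k _ hk; rw [Matrix.one_apply_ne hk.symm, TensorProduct.zero_tmul]
    · simp
  | hd =>
    rw [parabolicAct_detInv, canonicalMap_balLeft, canonicalMap_balRight, hv, coaction_detInv]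
    simp only [Algebra.TensorProduct.tmul_mul_tmul, one_mul, GLLoc.qdet_mul_detInv]
  | halg c =>
    rw [AlgHom.commutes]
    change canonicalMap (coaction q {ℓ}) (c • v.1) = _
    rw [map_smul, hv, ← Algebra.commutes, ← Algebra.smul_def, TensorProduct.tmul_smul]
  | hadd x y hx hy =>
    have e : ((parabolicAct q ℓ (x + y)).unop v).1 =
        ((parabolicAct q ℓ x).unop v).1 + ((parabolicAct q ℓ y).unop v).1 := by
      rw [map_add]; rfl
    rw [e, map_add, hx hv, hy hv, mul_add, TensorProduct.tmul_add]
  | hmul x y hx hy =>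
    rw [map_mul, ← mul_assoc]
    exact hy (hx hv)

theorem canonicalMap_canonicalInv (ℓ : Fin n) (z : Chart q ℓ ⊗[K] Parabolic q n) :
    canonicalMap (coaction q {ℓ}) (canonicalInv q ℓ z) = z := by
  induction z with
  | zero => simp
  | add x y hx hy => rw [map_add, map_add, hx, hy]
  | tmul x h =>
    have h1 : canonicalMap (coaction q {ℓ}) (chartOne q ℓ).1 = 1 ⊗ₜ 1 := by
      rw [chartOne, canonicalMap_balTmul, map_one, mul_one]
    rw [canonicalInv_tmul, canonicalMap_balLeft, canonicalMap_parabolicAct ℓ h h1,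
      Algebra.TensorProduct.tmul_mul_tmul, mul_one, one_mul, one_mul]

/-- Right `A_ℓ`-linearity reduces the left inverse property to the single value at `1 ⊗ 1`. On `a i
j` the product of the matrix `a` with its inverse collapses the double sum. -/
theorem canonicalInv_mul_coaction (ℓ : Fin n) (z : Chart q ℓ ⊗[K] Parabolic q n)
    (y : Chart q ℓ) :
    canonicalInv q ℓ (z * coaction q {ℓ} y) = chartRight y (canonicalInv q ℓ z) := by
  have hlin {y : Chart q ℓ} (h : ∀ x h, canonicalInv q ℓ (x ⊗ₜ h * coaction q {ℓ} y) =
      chartRight y (canonicalInv q ℓ (x ⊗ₜ h))) (z) :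
      canonicalInv q ℓ (z * coaction q {ℓ} y) = chartRight y (canonicalInv q ℓ z) := by
    induction z with
    | zero => simp
    | add x y hx hy => simp only [add_mul, map_add, hx, hy]
    | tmul x h' => exact h x h'
  have ha (i j) (z) : canonicalInv q ℓ (z * coaction q {ℓ} (GLLoc.a q {ℓ} i j)) =
      chartRight (GLLoc.a q {ℓ} i j) (canonicalInv q ℓ z) := by
    refine hlin (fun x h => ?_) z
    have h1 (k) : canonicalInv q ℓ (x ⊗ₜ h * GLLoc.a q {ℓ} i k ⊗ₜ Parabolic.p q n k j) =
        ∑ r, chartLeft x (chartLeft (GLLoc.a q {ℓ} i k * GLLoc.matInv q {ℓ} k r)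
          (chartRight (GLLoc.a q {ℓ} r j) ((parabolicAct q ℓ h).unop (chartOne q ℓ)).1)) := by
      rw [Algebra.TensorProduct.tmul_mul_tmul, canonicalInv_tmul, map_mul (parabolicAct q ℓ),
        MulOpposite.unop_mul, Module.End.mul_apply, parabolicAct_p, map_sum]
      refine Finset.sum_congr rfl fun r _ => ?_
      simp only [chartLeft, map_mul, Module.End.mul_apply]
    rw [coaction_a, Finset.mul_sum, map_sum]
    simp only [h1]
    rw [Finset.sum_comm]
    simp only [← map_sum, ← LinearMap.sum_apply, ← Matrix.mul_apply, GLLoc.a_mul_matInv]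
    rw [Finset.sum_eq_single i]
    · rw [Matrix.one_apply_eq, map_one, Module.End.one_apply, balLeft_balRight, canonicalInv_tmul]
    · intro k _ hk; rw [Matrix.one_apply_ne hk.symm]; simp
    · simp
  induction y using GLLoc.induction generalizing z with
  | ha i j => exact ha i j z
  | hd =>
    refine hlin (fun x h => ?_) z
    rw [coaction_detInv, Algebra.TensorProduct.tmul_mul_tmul, canonicalInv_tmul,
      map_mul (parabolicAct q ℓ), MulOpposite.unop_mul, Module.End.mul_apply, parabolicAct_detInv,
      ← Module.End.mul_apply, ← map_mul, mul_assoc, GLLoc.detInv_mul_qdet, mul_one,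
      balLeft_balRight, canonicalInv_tmul]
  | hi s =>
    -- Linearity in `a s 1 ⁻¹` follows from that in `a s 1`, used at `z δ(a s 1 ⁻¹)`; this is why
    -- `z` is arbitrary.
    have h1 := ha s 0 (z * coaction q {ℓ} (GLLoc.aInv q {ℓ} s))
    rw [mul_assoc, ← map_mul, GLLoc.aInv_mul_a, map_one, mul_one] at h1
    rw [h1, ← balRight_mul, GLLoc.a_mul_aInv, map_one]
    rfl
  | halg c =>
    rw [AlgHom.commutes, ← Algebra.commutes, ← Algebra.smul_def, map_smul, chartRight,
      AlgHom.commutes]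
    rfl
  | hadd x y hx hy =>
    rw [map_add (coaction q {ℓ}), mul_add, map_add, hx, hy, chartRight, chartRight, chartRight,
      map_add (balRight _)]
    rfl
  | hmul x y hx hy => rw [map_mul (coaction q {ℓ}), ← mul_assoc, hy, hx, balRight_mul]

theorem canonicalInv_canonicalMap (ℓ : Fin n) (v : ChartTensor q ℓ) :
    canonicalInv q ℓ (canonicalMap (coaction q {ℓ}) v) = v := by
  induction v using BalancedTensor.induction with
  | h0 => simp
  | htmul x y =>
    rw [canonicalMap_balTmul, canonicalInv_mul_coaction, canonicalInv_tmul, map_one]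
    change chartRight y (chartLeft x (balTmul _ 1 1)) = _
    rw [balLeft_balTmul, balRight_balTmul, mul_one, one_mul]
  | hadd v w hv hw => rw [map_add, map_add, hv, hw]

theorem isHopfGalois_coaction (q : Kˣ) (ℓ : Fin n) : IsHopfGalois (coaction q {ℓ}) :=
  ⟨Function.LeftInverse.injective (canonicalInv_canonicalMap ℓ),
    Function.RightInverse.surjective (canonicalMap_canonicalInv ℓ)⟩

end Galois

/-! ### The right adjoint action of `H` on the coinvariants. -/

noncomputable section ChartMapProperties

variable {K : Type*} [Field K] {n : ℕ} [NeZero n] {q : Kˣ}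

namespace Parabolic

theorem rightAdjoint_eq (k h : Parabolic q n) :
    rightAdjoint (K := K) k h = opSandwich (antipodeHom q n) k (comulHom q n h) := rfl

theorem rightAdjoint_one (k : Parabolic q n) : rightAdjoint (K := K) k 1 = k := by
  rw [rightAdjoint_eq, map_one, Algebra.TensorProduct.one_def, opSandwich_tmul, map_one]
  simp

theorem rightAdjoint_mul (k h h' : Parabolic q n) :
    rightAdjoint (K := K) k (h * h') = rightAdjoint (K := K) (rightAdjoint (K := K) k h) h' := by
  rw [rightAdjoint_eq, map_mul, opSandwich_mul]
  rfl

/-- As `k'` does not depend on the row `r`, it factors out of `∑ r, S(p i r) * p r j * k'`. -/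
theorem rightAdjoint_p {k k' : Parabolic q n} {j : Fin n}
    (h : ∀ r, k * p q n r j = p q n r j * k') (i : Fin n) :
    rightAdjoint (K := K) k (p q n i j) = if i = j then k' else 0 := by
  have e : rightAdjoint (K := K) k (p q n i j) = (pInv q n * p q n) i j * k' := by
    rw [rightAdjoint_eq, comulHom_p, map_sum, Matrix.mul_apply, Finset.sum_mul]
    refine Finset.sum_congr rfl fun r _ => ?_
    rw [opSandwich_tmul, antipodeHom_p, MulOpposite.unop_op, mul_assoc, mul_assoc, h]
  rw [e, pInv_mul_p, Matrix.one_apply, ite_mul, one_mul, zero_mul]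

theorem rightAdjoint_detInv {k k' : Parabolic q n} (h : k * detInv q n = detInv q n * k') :
    rightAdjoint (K := K) k (detInv q n) = k' := by
  rw [rightAdjoint_eq, comulHom_detInv, opSandwich_tmul, antipodeHom_detInv, MulOpposite.unop_op,
    mul_assoc, h, ← mul_assoc, qdet_mul_detInv, one_mul]

theorem mem_adjoin_beta (k : leviCoinv q n) :
    k ∈ Algebra.adjoin K (Set.range (beta q (n := n))) := by
  rw [adjoin_beta]; trivial

/-- Generators of `H` replace `k` by its rescaled form or by zero, and products of generators act
successively. -/
theorem rightAdjoint_mem (h : Parabolic q n) {k : Parabolic q n} (hk : k ∈ leviCoinv q n) :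
    rightAdjoint (K := K) k h ∈ leviCoinv q n := by
  induction h using induction generalizing k with
  | hp i j =>
    obtain ⟨k', -, h1, -⟩ := exists_twist (leviCoinv q n).val (leviCoinv q n).val
      (fun s => mu q j s * mu q 0 j) (mem_adjoin_beta ⟨k, hk⟩)
    have h2 (r) : k * p q n r j = p q n r j * k' := h1 _ fun s => beta_mul_p s r j
    rw [rightAdjoint_p h2]
    split_ifs
    · exact k'.2
    · exact zero_mem _
  | hd =>
    obtain ⟨k', -, h1, -⟩ := exists_twist (leviCoinv q n).val (leviCoinv q n).val
      (fun s => (∏ j, mu q j s * mu q 0 j)⁻¹) (mem_adjoin_beta ⟨k, hk⟩)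
    have h2 : k * detInv q n = detInv q n * k' := h1 _ fun s => beta_mul_detInv s
    rw [rightAdjoint_detInv h2]
    exact k'.2
  | halg c =>
    rw [Algebra.algebraMap_eq_smul_one, rightAdjoint_eq, map_smul, map_smul, ← rightAdjoint_eq,
      rightAdjoint_one]
    exact Subalgebra.smul_mem _ hk c
  | hadd x y hx hy =>
    rw [rightAdjoint_eq, map_add, map_add]
    exact add_mem (hx hk) (hy hk)
  | hmul x y hx hy =>
    rw [rightAdjoint_mul]
    exact hy (hx hk)

/-- The right adjoint action of `H` on the coinvariants. -/
def coinvAdjoint (k : leviCoinv q n) : Parabolic q n →ₗ[K] leviCoinv q n :=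
  LinearMap.codRestrict (Subalgebra.toSubmodule (leviCoinv q n))
    (opSandwich (antipodeHom q n) k ∘ₗ (comulHom q n).toLinearMap) fun h => rightAdjoint_mem h k.2

theorem coe_coinvAdjoint (k : leviCoinv q n) (h : Parabolic q n) :
    (coinvAdjoint k h : Parabolic q n) = rightAdjoint (K := K) (k : Parabolic q n) h := rfl

theorem coinvAdjoint_one (k : leviCoinv q n) : coinvAdjoint k 1 = k :=
  Subtype.ext (rightAdjoint_one _)

theorem coinvAdjoint_mul (k : leviCoinv q n) (h h' : Parabolic q n) :
    coinvAdjoint k (h * h') = coinvAdjoint (coinvAdjoint k h) h' :=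
  Subtype.ext (rightAdjoint_mul _ _ _)

end Parabolic

/-! ### Commutation rule, Miyashita-Ulbrich action and coaction for a map `f` with the prescribed
values. -/

open Parabolic

variable {ℓ : Fin n} (f : leviCoinv q n →ₐ[K] Chart q ℓ)

/-- The map `x ⊗ h ↦ x f(S(h₁) k h₂)`. -/
def adjointPairing (k : leviCoinv q n) : Chart q ℓ ⊗[K] Parabolic q n →ₗ[K] Chart q ℓ :=
  LinearMap.mul' K _ ∘ₗ TensorProduct.map .id (f.toLinearMap ∘ₗ coinvAdjoint k)

theorem adjointPairing_tmul (k : leviCoinv q n) (x : Chart q ℓ) (h : Parabolic q n) :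
    adjointPairing f k (x ⊗ₜ h) = x * f (coinvAdjoint k h) := rfl

/-- Since the adjoint action is an action, a left factor `x ⊗ h` only multiplies by `x` and replaces
`k` by `S(h₁) k h₂`. This makes the commutation rule multiplicative in `y`. -/
theorem adjointPairing_mul (k : leviCoinv q n) (x : Chart q ℓ) (h : Parabolic q n)
    (w : Chart q ℓ ⊗[K] Parabolic q n) :
    adjointPairing f k (x ⊗ₜ h * w) = x * adjointPairing f (coinvAdjoint k h) w := by
  induction w with
  | zero => simp
  | add w w' h1 h2 => simp only [mul_add, map_add, h1, h2]
  | tmul y h' =>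
    rw [Algebra.TensorProduct.tmul_mul_tmul, adjointPairing_tmul, adjointPairing_tmul,
      coinvAdjoint_mul, mul_assoc]

variable {f}

/-- Elements in the image of the coinvariants are moved past elements of the chart by the right
adjoint action: `f(k) y = y₀ f(S(y₁) k y₂)`. -/
theorem adjointPairing_coaction (hf : ∀ s, f (beta q s) = nu q ℓ s) (k : leviCoinv q n)
    (y : Chart q ℓ) : adjointPairing f k (coaction q {ℓ} y) = f k * y := by
  have hmul {y : Chart q ℓ} (hy : ∀ k, adjointPairing f k (coaction q {ℓ} y) = f k * y)
      (k) (w : Chart q ℓ ⊗[K] Parabolic q n) :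
      adjointPairing f k (w * coaction q {ℓ} y) = adjointPairing f k w * y := by
    induction w with
    | zero => simp
    | add w w' h1 h2 => simp only [add_mul, map_add, h1, h2]
    | tmul x h => rw [adjointPairing_mul, hy, adjointPairing_tmul, mul_assoc]
  have ha (i j) (k) : adjointPairing f k (coaction q {ℓ} (GLLoc.a q {ℓ} i j)) =
      f k * GLLoc.a q {ℓ} i j := by
    -- The equality of the scalars of `β s` in `H` and of `f(β s)` in the chart allows one `k'` for
    -- both: the adjoint action produces `k'`, and moving `f(k)` past `a i j` produces `f(k')`.
    obtain ⟨k', -, h1, h2⟩ := exists_twist (leviCoinv q n).val f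
      (fun s => mu q j s * mu q 0 j) (mem_adjoin_beta k)
    have h0 (r) : (k : Parabolic q n) * p q n r j = p q n r j * k' :=
      h1 _ fun s => beta_mul_p s r j
    have h3 (s) : coinvAdjoint k (p q n s j) = if s = j then k' else 0 := by
      refine Subtype.ext ?_
      rw [coe_coinvAdjoint, rightAdjoint_p h0]
      split_ifs <;> rfl
    rw [coaction_a, map_sum]
    simp only [adjointPairing_tmul, h3]
    rw [Finset.sum_eq_single j]
    · rw [if_pos rfl, h2 _ fun s => by rw [hf, nu_mul_a]]
    · intro s _ hs; rw [if_neg hs, map_zero, mul_zero]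
    · simp
  induction y using GLLoc.induction generalizing k with
  | ha i j => exact ha i j k
  | hd =>
    obtain ⟨k', -, h1, h2⟩ := exists_twist (leviCoinv q n).val f
      (fun s => (∏ j, mu q j s * mu q 0 j)⁻¹) (mem_adjoin_beta k)
    have h3 : coinvAdjoint k (detInv q n) = k' :=
      Subtype.ext (rightAdjoint_detInv (h1 _ fun s => beta_mul_detInv s))
    rw [coaction_detInv, adjointPairing_tmul, h3, h2 _ fun s => by rw [hf, nu_mul_detInv]]
  | hi s =>
    -- Appending `δ(a s 1)` to `δ(a s 1 ⁻¹)` gives `1`, so the case of the inverse follows without a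
    -- commutation relation for it.
    have h1 := hmul (ha s 0) k (coaction q {ℓ} (GLLoc.aInv q {ℓ} s))
    rw [← map_mul, GLLoc.aInv_mul_a, map_one, Algebra.TensorProduct.one_def, adjointPairing_tmul,
      coinvAdjoint_one, one_mul] at h1
    rw [h1, mul_assoc, GLLoc.a_mul_aInv, mul_one]
  | halg c =>
    rw [AlgHom.commutes, Algebra.algebraMap_eq_smul_one, map_smul, Algebra.TensorProduct.one_def,
      adjointPairing_tmul, coinvAdjoint_one, one_mul, Algebra.algebraMap_eq_smul_one,
      mul_smul_comm, mul_one]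
  | hadd x y hx hy => rw [map_add, map_add, hx, hy, mul_add]
  | hmul x y hx hy => rw [map_mul, hmul hy, hx, mul_assoc]

/-- For `δ b = b ⊗ 1` the commutation rule degenerates to `f(k) b = b f(k)`. -/
theorem map_mem_centralizer (hf : ∀ s, f (beta q s) = nu q ℓ s) (k : leviCoinv q n) :
    f k ∈ Subalgebra.centralizer K (coinvariants (coaction q {ℓ}) : Set (Chart q ℓ)) := by
  refine (Subalgebra.mem_centralizer_iff K).mpr fun b hb => ?_
  have h1 : coaction q {ℓ} b = b ⊗ₜ 1 := hb
  rw [← adjointPairing_coaction hf, h1, adjointPairing_tmul, coinvAdjoint_one]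

/-- The commutation rule says that `x ⊗ y ↦ x f(k) y` is `χ` followed by `x ⊗ h ↦ x f(S(h₁) k h₂)`;
at the translation map, `χ` cancels. -/
theorem map_rightAdjoint (hf : ∀ s, f (beta q s) = nu q ℓ s)
    (hG : IsHopfGalois (coaction q {ℓ})) (k : leviCoinv q n) (h : Parabolic q n) :
    f (coinvAdjoint k h) = miyashitaUlbrich hG ⟨f k, map_mem_centralizer hf k⟩ h := by
  have key : sandwich ⟨f k, map_mem_centralizer hf k⟩ =
      adjointPairing f k ∘ₗ canonicalMap (coaction q {ℓ}) := by
    refine BalancedTensor.hom_ext fun x y => ?_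
    rw [LinearMap.comp_apply, canonicalMap_balTmul, adjointPairing_mul, coinvAdjoint_one,
      adjointPairing_coaction hf, ← mul_assoc]
    rfl
  have h1 : canonicalMap (coaction q {ℓ}) (translationMap hG h) = 1 ⊗ₜ h :=
    (LinearEquiv.ofBijective _ hG).apply_symm_apply _
  rw [miyashitaUlbrich, key, LinearMap.comp_apply, h1, adjointPairing_tmul, one_mul]

theorem map_comul (hf : ∀ s, f (beta q s) = nu q ℓ s) (k : leviCoinv q n) :
    ∃ t : leviCoinv q n ⊗[K] Parabolic q n,
    Algebra.TensorProduct.map (leviCoinv q n).val (.id K _) t = comulHom q n k ∧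
      coaction q {ℓ} (f k) = Algebra.TensorProduct.map f (.id K _) t := by
  induction mem_adjoin_beta k using Algebra.adjoin_induction with
  | mem x hx =>
    obtain ⟨s, rfl⟩ := hx
    let u : Parabolic q n := ↑(pUnit q n)⁻¹
    -- `p 1 1` is group-like because `p r 1 = 0` for `r ≠ 1`; hence so is its inverse `u`.
    have e1 : comulHom q n u = u ⊗ₜ u := by
      have h1 : comulHom q n (p q n 0 0) = p q n 0 0 ⊗ₜ p q n 0 0 := by
        rw [comulHom_p, Finset.sum_eq_single 0]
        · intro r _ hr; rw [p_zero hr, TensorProduct.tmul_zero]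
        · simp
      refine left_inv_eq_right_inv (a := comulHom q n (p q n 0 0)) ?_ ?_
      · rw [← map_mul, pUnit_inv_mul_p, map_one]
      · rw [h1, Algebra.TensorProduct.tmul_mul_tmul, p_mul_pUnit_inv]; rfl
    -- Regrouping `(u ⊗ u) * ∑ r, p 1 r ⊗ p r s` gives this witness; `δ` of `a ℓ 1 ⁻¹ * a ℓ s` has
    -- the same right legs.
    refine ⟨∑ r, beta q r ⊗ₜ (u * p q n r s), ?_, ?_⟩
    · rw [coe_beta, map_mul, e1, comulHom_p, map_sum, Finset.mul_sum]
      refine Finset.sum_congr rfl fun r _ => ?_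
      rw [Algebra.TensorProduct.tmul_mul_tmul, Algebra.TensorProduct.map_tmul]
      rfl
    · rw [hf, nu, map_mul, coaction_aInv, coaction_a, map_sum, Finset.mul_sum]
      refine Finset.sum_congr rfl fun r _ => ?_
      rw [Algebra.TensorProduct.tmul_mul_tmul, Algebra.TensorProduct.map_tmul, hf]
      rfl
  | algebraMap c =>
    exact ⟨algebraMap K _ c, by rw [AlgHom.commutes, Subalgebra.coe_algebraMap, AlgHom.commutes],
      by rw [AlgHom.commutes, AlgHom.commutes, AlgHom.commutes]⟩
  | add x y _ _ hx hy =>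
    obtain ⟨t, h1, h2⟩ := hx
    obtain ⟨t', h3, h4⟩ := hy
    exact ⟨t + t', by rw [map_add, h1, h3, Subalgebra.coe_add, map_add],
      by rw [map_add f, map_add, h2, h4, map_add]⟩
  | mul x y _ _ hx hy =>
    obtain ⟨t, h1, h2⟩ := hx
    obtain ⟨t', h3, h4⟩ := hy
    exact ⟨t * t', by rw [map_mul, h1, h3, Subalgebra.coe_mul, map_mul],
      by rw [map_mul f, map_mul, h2, h4, map_mul]⟩

/-! ### Agreement on overlaps. -/

theorem localizationMap_a {S T : Set (Fin n)} (h : S ⊆ T) (i j : Fin n) :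
    localizationMap q h (GLLoc.a q S i j) = GLLoc.a q T i j := by
  unfold localizationMap
  rw [GLLoc.lift_a]

theorem localizationMap_aInv {S T : Set (Fin n)} (h : S ⊆ T) (i : S) :
    localizationMap q h (GLLoc.aInv q S i) = GLLoc.aInv q T ⟨i, h i.2⟩ := by
  unfold localizationMap
  rw [GLLoc.lift_aInv]

theorem restrictLeft_nu (ℓ m s : Fin n) : restrictLeft q ℓ m (nu q ℓ s) =
    GLLoc.aInv q {ℓ, m} ⟨ℓ, Or.inl rfl⟩ * GLLoc.a q {ℓ, m} ℓ s := by
  have hS : ({ℓ} : Set (Fin n)) ⊆ {ℓ, m} := fun _ hi => Or.inl hi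
  have e : restrictLeft q ℓ m = localizationMap q hS := rfl
  rw [nu, map_mul, e, localizationMap_aInv, localizationMap_a]

/-- The change of coordinates replaces row `m` by a left multiple of row `ℓ`, with factor `a m 1 * a
ℓ 1 ⁻¹`, and `a m 1` cancels against the `a m 1 ⁻¹` in front. -/
theorem restrictRight_nu {ℓ m : Fin n} (h : ℓ ≠ m) (s : Fin n) : restrictRight q h (nu q m s) =
    GLLoc.aInv q {ℓ, m} ⟨ℓ, Or.inl rfl⟩ * GLLoc.a q {ℓ, m} ℓ s := by
  have h1 : GLLoc.aInv q {ℓ, m} ⟨m, Or.inr rfl⟩ * GLLoc.a q {ℓ, m} m 0 = 1 :=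
    GLLoc.aInv_mul_a (S := {ℓ, m}) ⟨m, Or.inr rfl⟩
  have hS : ({m} : Set (Fin n)) ⊆ {ℓ, m} := fun _ hi => Or.inr hi
  have e : restrictRight q h = (chartChangeHom q h).comp (localizationMap q hS) := rfl
  rw [nu, map_mul, e, AlgHom.comp_apply, AlgHom.comp_apply,
    localizationMap_aInv, localizationMap_a, chartChangeHom, GLLoc.lift_aInv, GLLoc.lift_a,
    chartChange, if_neg h.symm, if_pos rfl, ← mul_assoc, ← mul_assoc, h1, one_mul]

end ChartMapProperties

end QuantumGL

theorem mainTheorem6 (n : ℕ) [NeZero n] (q : ℂˣ) :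
    ∃ hG : ∀ ℓ : Fin n, QuantumGL.IsHopfGalois (QuantumGL.coaction q {ℓ}),
      (∀ ℓ : Fin n, ∃! f : QuantumGL.Parabolic.leviCoinv q n →ₐ[ℂ] QuantumGL.Chart q ℓ,
        ∀ s : Fin n, s ≠ 0 → f (QuantumGL.Parabolic.beta q s) = QuantumGL.nu q ℓ s) ∧
      ∀ f : ∀ ℓ : Fin n, QuantumGL.Parabolic.leviCoinv q n →ₐ[ℂ] QuantumGL.Chart q ℓ,
        (∀ ℓ s : Fin n, s ≠ 0 → f ℓ (QuantumGL.Parabolic.beta q s) = QuantumGL.nu q ℓ s) →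
        ∃ hZ : ∀ (ℓ : Fin n) (k : QuantumGL.Parabolic.leviCoinv q n),
            f ℓ k ∈ Subalgebra.centralizer ℂ
              (QuantumGL.coinvariants (QuantumGL.coaction q {ℓ}) : Set (QuantumGL.Chart q ℓ)),
          (∀ (ℓ : Fin n) (k : QuantumGL.Parabolic.leviCoinv q n) (h : QuantumGL.Parabolic q n),
            ∃ hk : QuantumGL.rightAdjoint (K := ℂ) (k : QuantumGL.Parabolic q n) h ∈
                QuantumGL.Parabolic.leviCoinv q n,
              f ℓ ⟨QuantumGL.rightAdjoint (K := ℂ) (k : QuantumGL.Parabolic q n) h, hk⟩ =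
                QuantumGL.miyashitaUlbrich (hG ℓ) ⟨f ℓ k, hZ ℓ k⟩ h) ∧
          (∀ (ℓ : Fin n) (k : QuantumGL.Parabolic.leviCoinv q n),
            ∃ t : TensorProduct ℂ (QuantumGL.Parabolic.leviCoinv q n) (QuantumGL.Parabolic q n),
              TensorProduct.map (QuantumGL.Parabolic.leviCoinv q n).val.toLinearMap
                  LinearMap.id t =
                Coalgebra.comul (R := ℂ) (k : QuantumGL.Parabolic q n) ∧
              QuantumGL.coaction q {ℓ} (f ℓ k) =
                TensorProduct.map (f ℓ).toLinearMap LinearMap.id t) ∧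
          (∀ (ℓ m : Fin n) (h : ℓ < m),
            (QuantumGL.restrictLeft q ℓ m).comp (f ℓ) =
              (QuantumGL.restrictRight q h.ne).comp (f m)) := by
  -- The lemmas include the first index among the generators; there both sides are `1`, so the
  -- condition is automatic.
  have hbeta {ℓ : Fin n} {f : QuantumGL.Parabolic.leviCoinv q n →ₐ[ℂ] QuantumGL.Chart q ℓ}
      (hf : ∀ s : Fin n, s ≠ 0 → f (QuantumGL.Parabolic.beta q s) = QuantumGL.nu q ℓ s)
      (s : Fin n) : f (QuantumGL.Parabolic.beta q s) = QuantumGL.nu q ℓ s := by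
    by_cases hs : s = 0
    · rw [hs, QuantumGL.Parabolic.beta_zero, map_one, QuantumGL.nu_zero]
    · exact hf s hs
  refine ⟨QuantumGL.isHopfGalois_coaction q, fun ℓ => ⟨QuantumGL.chartMap q ℓ,
    fun s _ => QuantumGL.chartMap_beta ℓ s, fun g hg => ?_⟩, fun f hf =>
    ⟨fun ℓ => QuantumGL.map_mem_centralizer (hbeta (hf ℓ)), fun ℓ k h => ?_, fun ℓ k => ?_,
      fun ℓ m h => ?_⟩⟩
  · refine QuantumGL.Parabolic.leviCoinv_algHom_ext fun s hs => ?_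
    rw [hg s hs, QuantumGL.chartMap_beta]
  · exact ⟨QuantumGL.Parabolic.rightAdjoint_mem h k.2,
      QuantumGL.map_rightAdjoint (hbeta (hf ℓ)) _ k h⟩
  · exact QuantumGL.map_comul (hbeta (hf ℓ)) k
  · refine QuantumGL.Parabolic.leviCoinv_algHom_ext fun s hs => ?_
    rw [AlgHom.comp_apply, AlgHom.comp_apply, hf ℓ s hs, hf m s hs, QuantumGL.restrictLeft_nu,
      QuantumGL.restrictRight_nu]
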